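/- Let $\mathbf k$ be a field of characteristic $0$, $\lambda\in\mathbf k$, and let $V=\bigoplus_{i\in\mathbb Z}V_i$ be a graded $\mathbf k$-vector space with suspension $sV$, $(sV)_i=V_{i-1}$, and the degree $1$ map $s:V\to sV$. The Koszul sign rule is used throughout. For $f:(sV)^{\otimes p}\to sV$ and homogeneous $g_j:(sV)^{\otimes l_j}\to sV$ with $l_j\ge 1$ ($1\le j\le q$), let $f\{g_1,\dots,g_q\}=\sum f\circ(\mathrm{id}^{\otimes i_0}\otimes g_1\otimes \mathrm{id}^{\otimes i_1}\otimes\cdots\otimes g_q\otimes \mathrm{id}^{\otimes i_q})$, the sum running over $i_0,\dots,i_q\ge 0$ with $i_0+\dots+i_q+q=p$ (so it is $f$ for $q=0$, and $0$ for $q>p$). A homotopy Rota–Baxter algebra structure of weight $\lambda$ on $V$ consists of maps $b_n:(sV)^{\otimes n}\to sV$ and $R_n:(sV)^{\otimes n}\to V$ of degree $-1$, $n\ge 1$, such that for all $n\ge 1$ $$\sum_{j=1}^n b_{n-j+1}\{b_j\}=0,\qquad \sum_{l_1+\dots+l_k=n} b_k\circ(sR_{l_1}\otimes\cdots\otimes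 sR_{l_k})=\sum_{1\le q\le p}\ \sum_{r_1+\dots+r_q+p-q=n}\lambda^{p-q}\,(sR_{r_1})\{b_p\{sR_{r_2},\dots,sR_{r_q}\}\},$$ where $k,l_j,r_j\ge 1$. (Equivalently, $(\{b_n\},\{R_n\})$ is a Maurer–Cartan element of the $L_\infty$-algebra governing such structures.) An $A_\infty$-algebra structure on $V$ consists of maps $m_n:V^{\otimes n}\to V$ of degree $n-2$, $n\ge1$, with $\sum_{i+j+k=n,\ i,k\ge 0,\ j\ge 1}(-1)^{i+jk}m_{i+1+k}\circ(\mathrm{id}^{\otimes i}\otimes m_j\otimes\mathrm{id}^{\otimes k})=0$ for all $n\ge1$. An $A_\infty$-morphism from $(V,\{m_n\})$ to $(W,\{m'_n\})$ consists of maps $T_n:V^{\otimes n}\to W$ of degree $n-1$, $n\ge 1$, such that the maps $b_n=s\circ m_n\circ(s^{\otimes n})^{-1}$, $b'_n=s\circ m'_n\circ(s^{\otimes n})^{-1}$ and $\varphi_n=s\circ T_n\circ(s^{\otimes n})^{-1}$ satisfy, for all $n\ge 1$, $$\sum_{i+j+k=n,\ i,k\ge0,\ j\ge1}\varphi_{i+1+k}\circ(\mathrm{id}^{\otimes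 i}\otimes b_j\otimes\mathrm{id}^{\otimes k})=\sum_{r\ge 1}\ \sum_{i_1+\dots+i_r=n,\ i_j\ge1} b'_r\circ(\varphi_{i_1}\otimes\cdots\otimes\varphi_{i_r}).$$ Let $(\{b_n\}_{n\ge1},\{R_n\}_{n\ge1})$ be a homotopy Rota–Baxter algebra structure of weight $\lambda$ on $V$. Put $m_n=s^{-1}\circ b_n\circ s^{\otimes n}$, $T_n=R_n\circ s^{\otimes n}$, $$\widetilde b_n=\sum_{p=1}^n\sum_{q=0}^{p-1}\ \sum_{l_1+\dots+l_q+p-q=n,\ l_j\ge1}\lambda^{p-q-1}\,b_p\{sR_{l_1},\dots,sR_{l_q}\},\qquad \widetilde m_n=s^{-1}\circ\widetilde b_n\circ s^{\otimes n}.$$ Put $R^1_n=\lambda^{n-1}R_n$ and, for $k\ge2$, $$R^k_n=\sum_{1\le q\le p-1}\ \sum_{\substack{t_1,\dots,t_q\ge1\\ \max_j t_j=k-1}}\ \sum_{l_1+\dots+l_q+p-q=n,\ l_j\ge1}\lambda^{p-q-1}\,s^{-1}(sR_p)\{sR^{t_1}_{l_1},\dots,sR^{t_q}_{l_q}\},$$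 and $\widetilde R_n=\sum_{k\ge1}R^k_n$, a finite sum since $R^k_n=0$ for $k>n$. Then: 1. $(V,\{\widetilde m_n\}_{n\ge1})$ is an $A_\infty$-algebra, and $\{T_n\}_{n\ge1}$ is an $A_\infty$-morphism from $(V,\{\widetilde m_n\}_{n\ge1})$ to $(V,\{m_n\}_{n\ge1})$. 2. $(\{\widetilde b_n\}_{n\ge1},\{\widetilde R_n\}_{n\ge1})$ is again a homotopy Rota–Baxter algebra structure of weight $\lambda$ on $V$. -/

import Mathlib

open scoped DirectSum

namespace HomotopyRB

/-! ### Graded vector spaces, suspension and Koszul signs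

A graded space is a vector space `V` with subspaces `𝒱 i`, `i : ℤ`, such that `V = ⨁ i, 𝒱 i`
(a `DirectSum.Decomposition`). -/

/-- The grading of the suspension `sV`, where `(sV)_i = V_{i-1}`. The space underlying `sV` is the
one underlying `V`, and the degree `1` map `s : V → sV` is the identity of that space. -/
def suspGrading {k V : Type*} [Field k] [AddCommGroup V] [Module k V]
    (𝒱 : ℤ → Submodule k V) : ℤ → Submodule k V :=
  fun i => 𝒱 (i - 1)

theorem suspGrading_isInternal {k V : Type*} [Field k] [AddCommGroup V] [Module k V]
    (𝒱 : ℤ → Submodule k V) [DirectSum.Decomposition 𝒱] :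
    DirectSum.IsInternal (suspGrading 𝒱) := by
  have h := DirectSum.Decomposition.isInternal 𝒱
  rw [DirectSum.isInternal_submodule_iff_iSupIndep_and_iSup_eq_top] at h ⊢
  refine ⟨h.1.comp (sub_left_injective (b := (1 : ℤ))), ?_⟩
  rw [← h.2]
  exact (Equiv.subRight (1 : ℤ)).surjective.iSup_comp 𝒱

noncomputable instance suspDecomposition {k V : Type*} [Field k] [AddCommGroup V] [Module k V]
    (𝒱 : ℤ → Submodule k V) [DirectSum.Decomposition 𝒱] :
    DirectSum.Decomposition (suspGrading 𝒱) :=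
  (suspGrading_isInternal 𝒱).chooseDecomposition

/-- The Koszul sign operator: the linear map with `v ↦ (-1)^(d * |v|) v` for homogeneous `v`, that
is, the sign produced when an object of degree `d` moves past `v`. -/
noncomputable def koszul {k V : Type*} [Field k] [AddCommGroup V] [Module k V]
    (𝒱 : ℤ → Submodule k V) [DirectSum.Decomposition 𝒱] (d : ℤ) : V →ₗ[k] V :=
  DirectSum.toModule k ℤ V (fun i => (((d * i).negOnePow : ℤ) : k) • (𝒱 i).subtype) ∘ₗ
    (DirectSum.decomposeLinearEquiv 𝒱).toLinearMap

theorem koszul_apply_of_mem {k V : Type*} [Field k] [AddCommGroup V] [Module k V]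
    (𝒱 : ℤ → Submodule k V) [DirectSum.Decomposition 𝒱] (d : ℤ) {i : ℤ} {v : V} (hv : v ∈ 𝒱 i) :
    koszul 𝒱 d v = (((d * i).negOnePow : ℤ) : k) • v := by
  have h : (DirectSum.decomposeLinearEquiv 𝒱) v = DirectSum.lof k ℤ (fun i => 𝒱 i) i ⟨v, hv⟩ :=
    DirectSum.decompose_of_mem 𝒱 hv
  simp [koszul, h]

/-! ### Families of multilinear operations -/

/-- Families `(f_n)` of linear maps `f_n : V^{⊗ n} → W`. Only the members with `n ≥ 1` matter:
such a family stands for an element of `Hom(V ⊕ V^{⊗ 2} ⊕ ⋯, W)`, and no notion below about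
arities `n ≥ 1` looks at `f_0`. -/
abbrev Cochain (k V W : Type*) [Field k] [AddCommGroup V] [Module k V]
    [AddCommGroup W] [Module k W] :=
  (n : ℕ) → MultilinearMap k (fun _ : Fin n => V) W

/-- `f : V^{⊗ n} → W` is homogeneous of degree `d`. -/
def IsHomogeneous {k V W : Type*} [Field k] [AddCommGroup V] [Module k V]
    [AddCommGroup W] [Module k W] (𝒱 : ℤ → Submodule k V) (𝒲 : ℤ → Submodule k W) {n : ℕ}
    (f : MultilinearMap k (fun _ : Fin n => V) W) (d : ℤ) : Prop :=
  ∀ (e : Fin n → ℤ) (v : Fin n → V), (∀ i, v i ∈ 𝒱 (e i)) → f v ∈ 𝒲 ((∑ i, e i) + d)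

/-- The identity of `V`, as a family concentrated in arity `1`. -/
noncomputable def idCochain (k V : Type*) [Field k] [AddCommGroup V] [Module k V] :
    Cochain k V V :=
  Pi.single (M := fun n => MultilinearMap k (fun _ : Fin n => V) V) 1
    (MultilinearMap.ofSubsingleton k V V (0 : Fin 1) LinearMap.id)

/-- The member of arity `p` of a family, as a family concentrated in arity `p`. -/
noncomputable def arityPart {k V W : Type*} [Field k] [AddCommGroup V] [Module k V]
    [AddCommGroup W] [Module k W] (p : ℕ) (f : Cochain k V W) : Cochain k V W :=
  Pi.single (M := fun n => MultilinearMap k (fun _ : Fin n => V) W) p (f p)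

/-- The composite `f ∘ (g_1 ⊗ ⋯ ⊗ g_m) : V^{⊗ n} → X`, where the `n` inputs are cut into `m`
consecutive blocks by the composition `c` of `n` and `g_i : V^{⊗ l_i} → W` acts on the `i`-th one.
Here `g_i` has degree `d i`, and the Koszul rule is used: each input in the `i`-th block is passed
by every `g_j` with `i < j`. -/
noncomputable def koszulComp {k V W X : Type*} [Field k] [AddCommGroup V] [Module k V]
    [AddCommGroup W] [Module k W] [AddCommGroup X] [Module k X]
    (𝒱 : ℤ → Submodule k V) [DirectSum.Decomposition 𝒱] {n : ℕ} (c : Composition n)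
    (f : MultilinearMap k (fun _ : Fin c.length => W) X)
    (g : (i : Fin c.length) → MultilinearMap k (fun _ : Fin (c.blocksFun i) => V) W)
    (d : Fin c.length → ℤ) : MultilinearMap k (fun _ : Fin n => V) X :=
  (f.compMultilinearMap fun i =>
      (g i).compLinearMap fun _ => koszul 𝒱 (∑ j ∈ Finset.Ioi i, d j)).domDomCongr
    c.blocksFinEquiv

theorem koszulComp_apply {k V W X : Type*} [Field k] [AddCommGroup V] [Module k V]
    [AddCommGroup W] [Module k W] [AddCommGroup X] [Module k X]
    (𝒱 : ℤ → Submodule k V) [DirectSum.Decomposition 𝒱] {n : ℕ} (c : Composition n)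
    (f : MultilinearMap k (fun _ : Fin c.length => W) X)
    (g : (i : Fin c.length) → MultilinearMap k (fun _ : Fin (c.blocksFun i) => V) W)
    (d : Fin c.length → ℤ) (v : Fin n → V) :
    koszulComp 𝒱 c f g d v =
      f fun i => g i fun x => koszul 𝒱 (∑ j ∈ Finset.Ioi i, d j) (v (c.embedding i x)) :=
  rfl

/-- The brace `f{g_1, …, g_q}`, where `g_j` has degree `d j`:
`∑ ± f(a_1, …, g_1(…), …, g_2(…), …, g_q(…), …, a_n)`, over all ways to insert
`g_1, …, g_q` in this order and with values of all arities `≥ 1`, with Koszul signs. A term is given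
by a cutting `c` of the inputs into blocks and an increasing choice `e` of the blocks on which
`g_1, …, g_q` act; on the other blocks, which have size one, there is the identity. -/
noncomputable def brace {k V X : Type*} [Field k] [AddCommGroup V] [Module k V]
    [AddCommGroup X] [Module k X] (𝒱 : ℤ → Submodule k V) [DirectSum.Decomposition 𝒱] {q : ℕ}
    (f : Cochain k V X) (g : Fin q → Cochain k V V) (d : Fin q → ℤ) : Cochain k V X :=
  fun n => ∑ c : Composition n, ∑ e : Fin q ↪o Fin c.length,
    koszulComp 𝒱 c (f c.length)
      (fun i => Function.extend e g (fun _ => idCochain k V) i (c.blocksFun i))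
      (Function.extend e d (fun _ => 0))

/-- `∑ f_m ∘ (g_{l_1} ⊗ ⋯ ⊗ g_{l_m})` over all `m ≥ 1` and `l_1 + ⋯ + l_m = n` with all
`l_i ≥ 1`, where all members of the family `g` have degree `0`. -/
noncomputable def compAll {k V W X : Type*} [Field k] [AddCommGroup V] [Module k V]
    [AddCommGroup W] [Module k W] [AddCommGroup X] [Module k X]
    (𝒱 : ℤ → Submodule k V) [DirectSum.Decomposition 𝒱]
    (f : Cochain k W X) (g : Cochain k V W) : Cochain k V X :=
  fun n => ∑ c : Composition n,
    koszulComp 𝒱 c (f c.length) (fun i => g (c.blocksFun i)) (fun _ => 0)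

/-! ### Passing between `V` and `sV` -/

/-- From `f_n : (sV)^{⊗ n} → W` (or `→ sW`) to `f_n ∘ s^{⊗ n}` (or `s^{-1} ∘ f_n ∘ s^{⊗ n}`),
where `s^{⊗ n}(a_1 ⊗ ⋯ ⊗ a_n) = (-1)^{∑ (n-i)|a_i|} sa_1 ⊗ ⋯ ⊗ sa_n`. -/
noncomputable def desuspend {k V W : Type*} [Field k] [AddCommGroup V] [Module k V]
    [AddCommGroup W] [Module k W] (𝒱 : ℤ → Submodule k V) [DirectSum.Decomposition 𝒱]
    (f : Cochain k V W) : Cochain k V W :=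
  fun n => (f n).compLinearMap fun i => koszul 𝒱 ((n : ℤ) - 1 - (i : ℕ))

/-- From `f_n : V^{⊗ n} → W` to `s ∘ f_n ∘ (s^{⊗ n})^{-1} : (sV)^{⊗ n} → sW`, where
`(s^{⊗ n})^{-1}(sa_1 ⊗ ⋯ ⊗ sa_n) = (-1)^{∑ (n-i)|a_i|} a_1 ⊗ ⋯ ⊗ a_n`, with `|a_i|` the
degree in `V`. -/
noncomputable def suspend {k V W : Type*} [Field k] [AddCommGroup V] [Module k V]
    [AddCommGroup W] [Module k W] (𝒱 : ℤ → Submodule k V) [DirectSum.Decomposition 𝒱]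
    (f : Cochain k V W) : Cochain k V W :=
  fun n => (f n).compLinearMap fun i => koszul 𝒱 ((n : ℤ) - 1 - (i : ℕ))

/-! ### `A_∞`-algebras and their morphisms -/

/-- `A_∞`-algebra structures on `V`: operators `m_n : V^{⊗ n} → V` of degree `n - 2`, `n ≥ 1`, with
`∑_{i+j+k=n} (-1)^{i+jk} m_{i+1+k} ∘ (id^{⊗ i} ⊗ m_j ⊗ id^{⊗ k}) = 0` for `n ≥ 1`.
A summand is given by a cutting `c` of the inputs and the index `a` of the block of size `j` on which
`m_j` acts, the other blocks having size one; then `i = a` and `k = c.length - 1 - a`. -/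
structure IsAInfinityAlgebra {k V : Type*} [Field k] [AddCommGroup V] [Module k V]
    (𝒱 : ℤ → Submodule k V) [DirectSum.Decomposition 𝒱] (m : Cochain k V V) : Prop where
  degree : ∀ n, 1 ≤ n → IsHomogeneous 𝒱 𝒱 (m n) ((n : ℤ) - 2)
  stasheff : ∀ n, 1 ≤ n → ∑ c : Composition n, ∑ a : Fin c.length,
    (-1 : k) ^ ((a : ℕ) + c.blocksFun a * (c.length - 1 - (a : ℕ))) •
      koszulComp 𝒱 c (m c.length)
        (fun x => if x = a then m (c.blocksFun x) else idCochain k V (c.blocksFun x))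
        (fun x => if x = a then (c.blocksFun x : ℤ) - 2 else 0) = 0

/-- `A_∞`-morphisms `(V, m) → (W, m')`: operators `T_n : V^{⊗ n} → W` of degree `n - 1`, `n ≥ 1`,
such that for the corresponding `b_n : (sV)^{⊗ n} → sV`, `b'_n : (sW)^{⊗ n} → sW` of degree `-1`
and `φ_n : (sV)^{⊗ n} → sW` of degree `0` one has, for `n ≥ 1`,
`∑_{i+j+k=n} φ_{i+1+k} ∘ (id^{⊗ i} ⊗ b_j ⊗ id^{⊗ k})
  = ∑_{i_1+⋯+i_r=n} b'_r ∘ (φ_{i_1} ⊗ ⋯ ⊗ φ_{i_r})`. -/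
structure IsAInfinityMorphism {k V W : Type*} [Field k] [AddCommGroup V] [Module k V]
    [AddCommGroup W] [Module k W] (𝒱 : ℤ → Submodule k V) [DirectSum.Decomposition 𝒱]
    (𝒲 : ℤ → Submodule k W) [DirectSum.Decomposition 𝒲]
    (m : Cochain k V V) (m' : Cochain k W W) (T : Cochain k V W) : Prop where
  source : IsAInfinityAlgebra 𝒱 m
  target : IsAInfinityAlgebra 𝒲 m'
  degree : ∀ n, 1 ≤ n → IsHomogeneous 𝒱 𝒲 (T n) ((n : ℤ) - 1)
  morphism : ∀ n, 1 ≤ n →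
    brace (suspGrading 𝒱) (suspend 𝒱 T) (fun _ : Fin 1 => suspend 𝒱 m) (fun _ => -1) n =
      compAll (suspGrading 𝒱) (suspend 𝒲 m') (suspend 𝒱 T) n

/-! ### Homotopy Rota-Baxter algebras -/

/-- Homotopy Rota-Baxter algebra structures of weight `lam` on `V`: operators
`b_n : (sV)^{⊗ n} → sV` and `R_n : (sV)^{⊗ n} → V` of degree `-1`, `n ≥ 1`, such that for `n ≥ 1`
* `∑_{i+j+k=n} b_{i+1+k} ∘ (id^{⊗ i} ⊗ b_j ⊗ id^{⊗ k}) = 0`;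
* `∑_{l_1+⋯+l_r=n} b_r ∘ (sR_{l_1} ⊗ ⋯ ⊗ sR_{l_r}) = ∑_{1≤q≤p} ∑_{r_1+⋯+r_q+p-q=n}
    lam^{p-q} (sR_{r_1}){b_p{sR_{r_2}, …, sR_{r_q}}}`.

These are the components of the Maurer-Cartan equation for the pair of families. As `s` is the
identity of the underlying space, `R` also denotes the family `sR_n : (sV)^{⊗ n} → sV`, of degree
`0`. The sums over the arities `r_j` are contained in `brace`. -/
structure IsHomotopyRotaBaxter {k V : Type*} [Field k] [AddCommGroup V] [Module k V]
    (𝒱 : ℤ → Submodule k V) [DirectSum.Decomposition 𝒱] (lam : k) (b R : Cochain k V V) :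
    Prop where
  degree_b : ∀ n, 1 ≤ n → IsHomogeneous (suspGrading 𝒱) (suspGrading 𝒱) (b n) (-1)
  degree_R : ∀ n, 1 ≤ n → IsHomogeneous (suspGrading 𝒱) 𝒱 (R n) (-1)
  ainfinity : ∀ n, 1 ≤ n → brace (suspGrading 𝒱) b (fun _ : Fin 1 => b) (fun _ => -1) n = 0
  rotaBaxter : ∀ n, 1 ≤ n → compAll (suspGrading 𝒱) b R n =
    ∑ p ∈ Finset.Icc 1 n, ∑ q ∈ Finset.Icc 1 p, lam ^ (p - q) •
      brace (suspGrading 𝒱) R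
        (fun _ : Fin 1 =>
          brace (suspGrading 𝒱) (arityPart p b) (fun _ : Fin (q - 1) => R) (fun _ => 0))
        (fun _ => -1) n

/-- `b̃_n = ∑_{p=1}^n ∑_{q=0}^{p-1} ∑_{l_1+⋯+l_q+p-q=n} lam^{p-q-1} b_p{sR_{l_1}, …, sR_{l_q}}`. -/
noncomputable def bTilde {k V : Type*} [Field k] [AddCommGroup V] [Module k V]
    (𝒱 : ℤ → Submodule k V) [DirectSum.Decomposition 𝒱] (lam : k) (b R : Cochain k V V) :
    Cochain k V V :=
  fun n => ∑ p ∈ Finset.Icc 1 n, ∑ q ∈ Finset.range p, lam ^ (p - q - 1) •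
    brace (suspGrading 𝒱) (arityPart p b) (fun _ : Fin q => R) (fun _ => 0) n

/-- The families `R^j`, `j ≥ 1` (with `R^0 = 0`): `R^1_n = lam^{n-1} R_n`, and for `j ≥ 2`,
`R^j_n = ∑_{1≤q≤p-1} ∑_t ∑_{l_1+⋯+l_q+p-q=n} lam^{p-q-1}
  s^{-1} (sR_p){sR^{t_1}_{l_1}, …, sR^{t_q}_{l_q}}`
over all `t_1, …, t_q ≥ 1` with `max t_i = j - 1`. -/
noncomputable def RLevel {k V : Type*} [Field k] [AddCommGroup V] [Module k V]
    (𝒱 : ℤ → Submodule k V) [DirectSum.Decomposition 𝒱] (lam : k) (R : Cochain k V V) :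
    ℕ → Cochain k V V
  | 0 => fun _ => 0
  | 1 => fun n => lam ^ (n - 1) • R n
  | j + 2 => fun n => ∑ p ∈ Finset.Icc 1 n, ∑ q ∈ Finset.Icc 1 (p - 1),
      ∑ t : Fin q → Fin (j + 2) with (∀ i, 1 ≤ (t i : ℕ)) ∧ ∃ i, (t i : ℕ) = j + 1,
        lam ^ (p - q - 1) • brace (suspGrading 𝒱) (arityPart p R)
          (fun i => RLevel 𝒱 lam R (t i)) (fun _ => 0) n
termination_by j => j
decreasing_by exact (t i).isLt

theorem RLevel_eq_zero {k V : Type*} [Field k] [AddCommGroup V] [Module k V]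
    (𝒱 : ℤ → Submodule k V) [DirectSum.Decomposition 𝒱] (lam : k) (R : Cochain k V V)
    (n : ℕ) : ∀ j, 1 ≤ n → n < j → RLevel 𝒱 lam R j n = 0 := by
  induction n using Nat.strong_induction_on with
  | _ n ih =>
    intro j hn hj
    obtain ⟨j, rfl⟩ : ∃ i, j = i + 2 := ⟨j - 2, by omega⟩
    rw [RLevel]
    refine Finset.sum_eq_zero fun p hp => Finset.sum_eq_zero fun q hq =>
      Finset.sum_eq_zero fun t ht => ?_
    obtain ⟨-, i, hi⟩ := (Finset.mem_filter.1 ht).2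
    rw [Finset.mem_Icc] at hq
    rw [brace, Finset.sum_eq_zero, smul_zero]
    refine fun c _ => Finset.sum_eq_zero fun e _ => ?_
    ext v
    rw [koszulComp_apply]
    by_cases hc : c.length = p
    · refine MultilinearMap.map_coord_zero _ (e i) ?_
      have hlt : c.blocksFun (e i) < n := by
        have h2 : ∃ x : Fin c.length, x ≠ e i := by
          have : Nontrivial (Fin c.length) := Fin.nontrivial_iff_two_le.2 (by omega)
          exact exists_ne _
        obtain ⟨x, hx⟩ := h2
        have hs := Finset.add_le_sum (f := c.blocksFun) (s := Finset.univ) (fun _ _ => Nat.zero_le _)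
          (Finset.mem_univ x) (Finset.mem_univ (e i)) hx
        have := c.one_le_blocksFun x
        rw [c.sum_blocksFun] at hs
        omega
      rw [e.injective.extend_apply, ih _ hlt _ (c.one_le_blocksFun _) (by omega)]
      rfl
    · rw [arityPart, Pi.single_eq_of_ne hc]
      rfl

/-- `R̃_n = ∑_{j ≥ 1} R^j_n`. The sum stops at `j = n`, see `RLevel_eq_zero`. -/
noncomputable def RTilde {k V : Type*} [Field k] [AddCommGroup V] [Module k V]
    (𝒱 : ℤ → Submodule k V) [DirectSum.Decomposition 𝒱] (lam : k) (R : Cochain k V V) :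
    Cochain k V V :=
  fun n => ∑ j ∈ Finset.Icc 1 n, RLevel 𝒱 lam R j n

end HomotopyRB

/-! Write f⟨A,B,C⟩ for `tri f (row A B C)`, the sum of all f(A,…,A,B,C,…,C) with B exactly once, σ
for the Koszul sign operator of degree -1 on sV, and P = R + λ·id. Splitting a proper subset of the
inputs of b at its first gap gives b̃ = b⟨R,1,P⟩. This is the divided difference of b between R and
P, in a form that also makes sense for λ = 0. The Rota–Baxter equation becomes b∘R = R⟨σ,b̃,1⟩,
which is the morphism equation once the suspensions are removed. Adding λb̃ to both sides gives b∘P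
= P⟨σ,b̃,1⟩.

Nesting two such insertions gives a sum over two marked slots with a 3×3 grid of entries (`dtri`,
`tri_tri`), and transposing the grid does not change the sum (`dtri_swap`). The grid of b̃⟨σ,b̃,1⟩
is the transpose of that of (b⟨σ,b,1⟩)⟨R,1,P⟩ = 0, so b̃ squares to zero (`tri_twist_self`).

The families R^j are the increments of the iteration S ↦ R⟨S,1,S+λ⟩ started at 0, so R̃ is a fixed
point (`RTilde_eq_tri`). For the Rota–Baxter equation of (b̃, R̃), the grid expansion shows that its
defect e reproduces itself in the middle row (e,0,e) of a grid for R. There e always stands beside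
another nonempty block, hence has smaller arity, and induction gives e = 0 (`comp_twist`).

What remains is the dictionary: braces and their weights (`sum_brace_eq_tri`, `sum_brace_brace`),
degrees, and the comparison of the signed Stasheff identities with the suspended ones
(`stasheff_eq_desuspend_brace`). -/

namespace HomotopyRB

/-! ### Sign-free calculus of families: composition, marked insertions, chain rule. -/

section Calculus

variable {k E F G H : Type*} [Field k] [AddCommGroup E] [Module k E] [AddCommGroup F] [Module k F]
  [AddCommGroup G] [Module k G] [AddCommGroup H] [Module k H]

theorem Cochain.congr (f : Cochain k E F) {m n : ℕ} {v : Fin m → E} {w : Fin n → E} (h : m = n)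
    (hvw : ∀ (i : ℕ) (him : i < m) (hin : i < n), v ⟨i, him⟩ = w ⟨i, hin⟩) : f m v = f n w := by
  subst h
  congr 1 with ⟨i, hi⟩
  exact hvw i hi hi

/-- The composite `∑ f_m ∘ (g_{l_1} ⊗ ⋯ ⊗ g_{l_m})`, without signs. -/
noncomputable def comp (f : Cochain k F G) (g : Cochain k E F) : Cochain k E G :=
  fun n => ∑ c : Composition n,
    ((f c.length).compMultilinearMap fun i => g (c.blocksFun i)).domDomCongr c.blocksFinEquiv

theorem comp_apply (f : Cochain k F G) (g : Cochain k E F) (n : ℕ) (v : Fin n → E) :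
    comp f g n v =
      ∑ c : Composition n, f c.length fun i => g (c.blocksFun i) fun x => v (c.embedding i x) := by
  simp only [comp, sum_apply]
  rfl

/-- Both sides run over two-level cuttings of the inputs: either cut finely and then group the
blocks, or cut coarsely and then refine each block. `Composition.sigmaEquivSigmaPi` matches the two
descriptions. -/
theorem comp_assoc (r : Cochain k G H) (q : Cochain k F G) (p : Cochain k E F) :
    comp (comp r q) p = comp r (comp q p) := by
  ext n v
  let f : (Σ a : Composition n, Composition a.length) → H := fun c =>
    r c.2.length fun i => q (c.2.blocksFun i) fun j =>
      p (c.1.blocksFun (c.2.embedding i j)) fun x => v (c.1.embedding (c.2.embedding i j) x)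
  let g : (Σ c : Composition n, ∀ i : Fin c.length, Composition (c.blocksFun i)) → H := fun c =>
    r c.1.length fun i : Fin c.1.length =>
      q (c.2 i).length fun j =>
        p ((c.2 i).blocksFun j) fun x => v (c.1.embedding i ((c.2 i).embedding j x))
  suffices ∑ c, f c = ∑ c, g c by
    simpa only [comp_apply, MultilinearMap.map_sum, Finset.sum_sigma', Finset.univ_sigma_univ, f, g]
      using this
  rw [← (Composition.sigmaEquivSigmaPi n).sum_comp]
  refine Finset.sum_congr rfl ?_
  rintro ⟨a, b⟩ _
  refine r.congr (Composition.length_gather a b).symm fun i hi1 hi2 => ?_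
  refine q.congr (Composition.length_sigmaCompositionAux a b ⟨i, hi1⟩).symm fun j hj1 hj2 => ?_
  refine p.congr (Composition.blocksFun_sigmaCompositionAux a b ⟨i, hi1⟩ ⟨j, hj1⟩).symm
    fun x hx1 hx2 => ?_
  refine congrArg v (Fin.ext ?_)
  have := Composition.sizeUpTo_sizeUpTo_add a b hi1 hj1
  simp only [Composition.coe_embedding, Composition.sigmaEquivSigmaPi, Equiv.coe_fn_mk]
  rw [this, add_assoc]
  rfl

/-- A linear map as a family concentrated in arity `1`. -/
noncomputable def lin (L : E →ₗ[k] F) : Cochain k E F :=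
  fun n => L.compMultilinearMap (idCochain k E n)

theorem idCochain_one_apply (v : Fin 1 → E) : idCochain k E 1 v = v 0 := by
  simp [idCochain]

theorem idCochain_of_ne {n : ℕ} (h : n ≠ 1) : idCochain k E n = 0 := by
  simp [idCochain, h]

theorem lin_one_apply (L : E →ₗ[k] F) (v : Fin 1 → E) : lin L 1 v = L (v 0) := by
  simp [lin, idCochain_one_apply]

theorem lin_of_ne (L : E →ₗ[k] F) {n : ℕ} (h : n ≠ 1) : lin L n = 0 := by
  ext v
  simp [lin, idCochain_of_ne h]

theorem lin_id : lin (LinearMap.id : E →ₗ[k] E) = idCochain k E := by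
  ext n v
  rfl

theorem comp_lin (f : Cochain k F G) (L : E →ₗ[k] F) (n : ℕ) (v : Fin n → E) :
    comp f (lin L) n v = f n fun i => L (v i) := by
  rw [comp_apply, Finset.sum_eq_single (Composition.ones n)]
  · refine f.congr (Composition.ones_length n) fun i hi1 hi2 => ?_
    have h : (Composition.ones n).blocksFun ⟨i, hi1⟩ = 1 := Composition.ones_blocksFun n _
    rw [(lin L).congr (w := fun _ => v ⟨i, hi2⟩) h, lin_one_apply]
    intro x hx1 hx2
    congr 1
    ext
    have : x = 0 := by omega
    subst this
    simp
  · intro c _ hc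
    obtain ⟨j, hj, hj1⟩ := Composition.ne_ones_iff.1 hc
    obtain ⟨a, rfl⟩ := List.get_of_mem hj
    refine MultilinearMap.map_coord_zero _ a ?_
    have : c.blocksFun a ≠ 1 := by
      simp only [Composition.blocksFun]
      exact hj1.ne'
    rw [lin_of_ne L this]
    rfl
  · simp

theorem comp_id (f : Cochain k E F) : comp f (idCochain k E) = f := by
  ext n v
  rw [← lin_id, comp_lin]
  rfl

theorem lin_comp (L : F →ₗ[k] G) {g : Cochain k E F} (hg : g 0 = 0) :
    comp (lin L) g = fun n => L.compMultilinearMap (g n) := by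
  ext n v
  rw [comp_apply]
  rcases Nat.eq_zero_or_pos n with rfl | hn
  · rw [Finset.sum_eq_zero]
    · simp [hg]
    · intro c _
      have : c.length ≠ 1 := by
        have := c.length_le
        omega
      rw [lin_of_ne L this]
      rfl
  · rw [Finset.sum_eq_single (Composition.single n hn)]
    · rw [(lin L).congr (w := fun _ => g n v) (Composition.single_length hn), lin_one_apply]
      · rfl
      · intro i hi1 hi2
        refine g.congr (Composition.single_blocksFun hn _) fun x hx1 hx2 => ?_
        have : i = 0 := by omega
        subst this
        congr 1
        ext
        rw [Composition.coe_embedding]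
        simp
    · intro c _ hc
      have : c.length ≠ 1 := fun h => hc ((Composition.eq_single_iff_length hn).2 h)
      rw [lin_of_ne L this]
      rfl
    · simp

theorem id_comp {g : Cochain k E F} (hg : g 0 = 0) : comp (idCochain k F) g = g := by
  rw [← lin_id, lin_comp _ hg]
  ext n v
  rfl

/-- Three objects as a function on `Ordering`. -/
def row {α : Type*} (A B C : α) : Ordering → α
  | .lt => A
  | .eq => B
  | .gt => C

@[simp] theorem row_lt {α : Type*} (A B C : α) : row A B C .lt = A := rfl
@[simp] theorem row_eq {α : Type*} (A B C : α) : row A B C .eq = B := rfl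
@[simp] theorem row_gt {α : Type*} (A B C : α) : row A B C .gt = C := rfl

theorem comp_row {α β : Type*} (φ : α → β) (A B C : α) (o : Ordering) :
    φ (row A B C o) = row (φ A) (φ B) (φ C) o := by
  cases o <;> rfl

/-- The family `(w_1, …, w_n) ↦ ∑_i f(w_1^<, …, w_{i-1}^<, w_i^=, w_{i+1}^>, …, w_n^>)` on triples
`w = (w^<, w^=, w^>)`. -/
noncomputable def polar (f : Cochain k E F) : Cochain k (Ordering → E) F :=
  fun n => ∑ i, (f n).compLinearMap fun l => LinearMap.proj (cmp l i)

theorem polar_apply (f : Cochain k E F) (n : ℕ) (w : Fin n → Ordering → E) :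
    polar f n w = ∑ i, f n fun l => w l (cmp l i) := by
  simp only [polar, sum_apply]
  rfl

/-- A family of families as a single family with values in a product. -/
def pack {ι : Type*} (g : ι → Cochain k E F) : Cochain k E (ι → F) :=
  fun n => MultilinearMap.pi fun o => g o n

theorem pack_apply {ι : Type*} (g : ι → Cochain k E F) (n : ℕ) (v : Fin n → E) (o : ι) :
    pack g n v o = g o n v := rfl

/-- The family `∑ f(g^<, …, g^<, g^=, g^>, …, g^>)`, with the member `g^=` occurring exactly
once. -/
noncomputable def tri (f : Cochain k F G) (g : Ordering → Cochain k E F) : Cochain k E G :=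
  comp (polar f) (pack g)

theorem tri_apply (f : Cochain k F G) (g : Ordering → Cochain k E F) (n : ℕ) (v : Fin n → E) :
    tri f g n v = ∑ c : Composition n, ∑ a : Fin c.length, f c.length fun i =>
      g (cmp i a) (c.blocksFun i) fun x => v (c.embedding i x) := by
  simp only [tri, comp_apply, polar_apply, pack_apply]

theorem tri_zero_arity (f : Cochain k F G) (g : Ordering → Cochain k E F) : tri f g 0 = 0 := by
  ext v
  rw [tri_apply]
  refine Finset.sum_eq_zero fun c _ => ?_
  have : IsEmpty (Fin c.length) := by
    have : c.length = 0 := by simp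
    rw [this]
    infer_instance
  simp

theorem comp_zero_arity {f : Cochain k F G} (hf : f 0 = 0) (g : Cochain k E F) :
    comp f g 0 = 0 := by
  ext v
  rw [comp_apply]
  refine Finset.sum_eq_zero fun c _ => ?_
  have h : c.length = 0 := by simp
  rw [f.congr (w := fun i => i.elim0) h, hf]
  · rfl
  · intro i _ hi
    omega

theorem pack_comp {ι : Type*} (g : ι → Cochain k F G) (h : Cochain k E F) :
    comp (pack g) h = pack fun o => comp (g o) h := by
  ext n v o
  simp [comp_apply, pack_apply]

theorem polar_pack {ι : Type*} (g : ι → Cochain k E F) :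
    polar (pack g) = pack fun o => polar (g o) := by
  ext n v o
  simp [polar_apply, pack_apply]

theorem pack_tri {ι : Type*} (g : ι → Cochain k F G) (h : Ordering → Cochain k E F) :
    tri (pack g) h = pack fun o => tri (g o) h := by
  rw [tri, polar_pack, pack_comp]
  rfl

theorem cmp_embedding {n : ℕ} (c : Composition n) (i j : Fin c.length) (x : Fin (c.blocksFun i))
    (y : Fin (c.blocksFun j)) :
    (i < j → cmp (c.embedding i x) (c.embedding j y) = .lt) ∧
      (j < i → cmp (c.embedding i x) (c.embedding j y) = .gt) := by
  have key : ∀ (i j : Fin c.length) (x : Fin (c.blocksFun i)) (y : Fin (c.blocksFun j)),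
      i < j → c.embedding i x < c.embedding j y := by
    intro i j x y h
    rw [Fin.lt_def, Composition.coe_embedding, Composition.coe_embedding]
    have h1 : c.sizeUpTo (i + 1) ≤ c.sizeUpTo j := c.monotone_sizeUpTo (Nat.succ_le_of_lt h)
    rw [c.sizeUpTo_succ'] at h1
    have := x.2
    omega
  exact ⟨fun h => (key i j x y h).cmp_eq_lt, fun h => (key j i y x h).cmp_eq_gt⟩

/-- The chain rule. -/
theorem polar_comp (f : Cochain k F G) (g : Cochain k E F) :
    polar (comp f g) = tri f (row (fun n => (g n).compLinearMap fun _ => LinearMap.proj .lt)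
      (polar g) (fun n => (g n).compLinearMap fun _ => LinearMap.proj .gt)) := by
  funext n
  refine MultilinearMap.ext fun w => ?_
  rw [polar_apply, tri_apply]
  simp only [comp_apply]
  rw [Finset.sum_comm]
  refine Finset.sum_congr rfl fun c _ => ?_
  -- Marking one of the n inputs is the same as marking a block `a` and then an input inside it.
  rw [← c.blocksFinEquiv.sum_comp, Fintype.sum_sigma]
  refine Finset.sum_congr rfl fun a _ => ?_
  set z : Fin c.length → F := fun i =>
    g (c.blocksFun i) fun x => w (c.embedding i x) (cmp i a) with hz
  have hr : (fun i => row (fun n => (g n).compLinearMap fun _ => LinearMap.proj Ordering.lt)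
      (polar g) (fun n => (g n).compLinearMap fun _ => LinearMap.proj Ordering.gt) (cmp i a)
      (c.blocksFun i) fun x => w (c.embedding i x)) =
      Function.update z a (polar g (c.blocksFun a) fun x => w (c.embedding a x)) := by
    ext i
    rcases lt_trichotomy i a with h | rfl | h
    · simp [Function.update_of_ne h.ne, hz, h.cmp_eq_lt]
    · simp
    · simp [Function.update_of_ne h.ne', hz, h.cmp_eq_gt]
  rw [hr, polar_apply, MultilinearMap.map_update_sum]
  refine Finset.sum_congr rfl fun y _ => ?_
  congr 1
  ext i
  change g (c.blocksFun i) (fun x => w (c.embedding i x)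
    (cmp (c.embedding i x) (c.embedding a y))) = _
  rcases lt_trichotomy i a with h | rfl | h
  · simp [Function.update_of_ne h.ne, hz, h.cmp_eq_lt, (cmp_embedding c i a _ y).1 h]
  · simp only [Function.update_self]
    congr 1
    ext x
    congr 1
    exact (c.embedding i).strictMono.cmp_map_eq x y
  · simp [Function.update_of_ne h.ne', hz, h.cmp_eq_gt, (cmp_embedding c i a _ y).2 h]

theorem comp_proj_pack (g : Cochain k F G) (h : Ordering → Cochain k E F) (o : Ordering) :
    comp (fun n => (g n).compLinearMap fun _ => LinearMap.proj o) (pack h) = comp g (h o) := by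
  ext n v
  simp only [comp_apply]
  rfl

theorem tri_comp_left (f : Cochain k F G) (g : Ordering → Cochain k H F) (h : Cochain k E H) :
    comp (tri f g) h = tri f fun o => comp (g o) h := by
  rw [tri, comp_assoc, pack_comp]
  rfl

theorem tri_comp (f : Cochain k G H) (g : Cochain k F G) (h : Ordering → Cochain k E F) :
    tri (comp f g) h = tri f (row (comp g (h .lt)) (tri g h) (comp g (h .gt))) := by
  rw [tri, polar_comp, tri_comp_left]
  congr 1
  ext1 o
  cases o
  · exact comp_proj_pack g h .lt
  · rfl
  · exact comp_proj_pack g h .gt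

/-- The twofold iterate of `tri`. -/
noncomputable def dtri (f : Cochain k F G) (g : Ordering → Ordering → Cochain k E F) :
    Cochain k E G :=
  tri (polar f) fun o => pack (g o)

theorem dtri_apply (f : Cochain k F G) (g : Ordering → Ordering → Cochain k E F) (n : ℕ)
    (v : Fin n → E) :
    dtri f g n v = ∑ c : Composition n, ∑ a : Fin c.length, ∑ a' : Fin c.length,
      f c.length fun i => g (cmp i a) (cmp i a') (c.blocksFun i) fun x => v (c.embedding i x) := by
  simp only [dtri, tri_apply, polar_apply, pack_apply]

/-- The two marked slots play symmetric roles, so the grid may be transposed. Both main computations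
rest on this. -/
theorem dtri_swap (f : Cochain k F G) (g : Ordering → Ordering → Cochain k E F) :
    dtri f g = dtri f fun o o' => g o' o := by
  ext n v
  simp only [dtri_apply]
  exact Finset.sum_congr rfl fun c _ => Finset.sum_comm

/-- The chain rule for the outer insertion: each entry of `g` is composed with `h .lt` before the
outer mark, with `h .gt` after it, and itself receives the mark in the middle. -/
theorem tri_tri (f : Cochain k G H) (g : Ordering → Cochain k F G)
    (h : Ordering → Cochain k E F) :
    tri (tri f g) h = dtri f (row (fun o => comp (g o) (h .lt)) (fun o => tri (g o) h)
      (fun o => comp (g o) (h .gt))) := by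
  change tri (comp (polar f) (pack g)) h = _
  rw [tri_comp, dtri, pack_comp, pack_comp, pack_tri]
  congr 1
  ext1 o
  cases o <;> rfl

end Calculus

/-! ### Linearity in each argument, finite differences, vanishing by arity. -/

section Linearity

variable {k E F G : Type*} [Field k] [AddCommGroup E] [Module k E] [AddCommGroup F] [Module k F]
  [AddCommGroup G] [Module k G]

theorem comp_congr {f f' : Cochain k F G} {g g' : Cochain k E F} {n : ℕ} (hn : 1 ≤ n)
    (hf : ∀ m, 1 ≤ m → m ≤ n → f m = f' m) (hg : ∀ m, 1 ≤ m → m ≤ n → g m = g' m) :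
    comp f g n = comp f' g' n := by
  ext v
  rw [comp_apply, comp_apply]
  refine Finset.sum_congr rfl fun c _ => ?_
  rw [hf _ (c.length_pos_iff.2 hn) c.length_le]
  congr 1
  ext i
  rw [hg _ (c.one_le_blocksFun i) (c.blocksFun_le i)]

theorem tri_congr {f f' : Cochain k F G} {g g' : Ordering → Cochain k E F} {n : ℕ}
    (hf : ∀ m, 1 ≤ m → m ≤ n → f m = f' m) (hg : ∀ o m, 1 ≤ m → m ≤ n → g o m = g' o m) :
    tri f g n = tri f' g' n := by
  ext v
  rw [tri_apply, tri_apply]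
  refine Finset.sum_congr rfl fun c _ => Finset.sum_congr rfl fun a _ => ?_
  rw [hf _ a.pos c.length_le]
  congr 1
  ext i
  rw [hg _ _ (c.one_le_blocksFun i) (c.blocksFun_le i)]

theorem lin_tri (L : F →ₗ[k] G) {g : Ordering → Cochain k E F} (hg : g .eq 0 = 0) :
    tri (lin L) g = fun n => L.compMultilinearMap (g .eq n) := by
  have h : polar (lin L) = fun n => (lin L n).compLinearMap fun _ => LinearMap.proj .eq := by
    funext n
    refine MultilinearMap.ext fun w => ?_
    rw [polar_apply]
    by_cases hn : n = 1
    · subst hn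
      simp [lin_one_apply]
    · simp [lin_of_ne L hn]
  rw [tri, h, comp_proj_pack, lin_comp L hg]

theorem lin_tri_id (L : E →ₗ[k] F) {g : Ordering → Cochain k E E} (hg : g .eq = idCochain k E) :
    tri (lin L) g = lin L := by
  rw [lin_tri, hg]
  · rfl
  · rw [hg, idCochain_of_ne zero_ne_one]

theorem id_tri {g : Ordering → Cochain k E F} (hg : g .eq 0 = 0) :
    tri (idCochain k F) g = g .eq := by
  rw [← lin_id, lin_tri _ hg]
  rfl

theorem comp_add_left (f f' : Cochain k F G) (g : Cochain k E F) :
    comp (f + f') g = comp f g + comp f' g := by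
  ext n v
  simp [comp_apply, Finset.sum_add_distrib]

theorem comp_smul_left (r : k) (f : Cochain k F G) (g : Cochain k E F) :
    comp (r • f) g = r • comp f g := by
  ext n v
  simp [comp_apply, Finset.smul_sum]

theorem polar_add (f f' : Cochain k E F) : polar (f + f') = polar f + polar f' := by
  funext n
  refine MultilinearMap.ext fun w => ?_
  simp [polar_apply, Finset.sum_add_distrib]

theorem polar_smul (r : k) (f : Cochain k E F) : polar (r • f) = r • polar f := by
  funext n
  refine MultilinearMap.ext fun w => ?_
  simp [polar_apply, Finset.smul_sum]

theorem tri_add_left (f f' : Cochain k F G) (g : Ordering → Cochain k E F) :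
    tri (f + f') g = tri f g + tri f' g := by
  rw [tri, polar_add, comp_add_left]
  rfl

theorem tri_smul_left (r : k) (f : Cochain k F G) (g : Ordering → Cochain k E F) :
    tri (r • f) g = r • tri f g := by
  rw [tri, polar_smul, comp_smul_left]
  rfl

theorem tri_zero_left (g : Ordering → Cochain k E F) : tri (0 : Cochain k F G) g = 0 := by
  ext n v
  simp [tri_apply]

theorem row_eq_update {n : ℕ} (c : Composition n) (a : Fin c.length) (A B C : Cochain k E F)
    (v : Fin n → E) :
    (fun i => row A B C (cmp i a) (c.blocksFun i) fun x => v (c.embedding i x)) =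
      Function.update (fun i => row A 0 C (cmp i a) (c.blocksFun i) fun x => v (c.embedding i x)) a
        (B (c.blocksFun a) fun x => v (c.embedding a x)) := by
  ext i
  rcases eq_or_ne i a with rfl | h
  · simp
  · rw [Function.update_of_ne h]
    rcases h.lt_or_gt with h | h
    · simp [h.cmp_eq_lt]
    · simp [h.cmp_eq_gt]

theorem tri_row_add (f : Cochain k F G) (A B B' C : Cochain k E F) :
    tri f (row A (B + B') C) = tri f (row A B C) + tri f (row A B' C) := by
  ext n v
  simp only [Pi.add_apply, add_apply, tri_apply, ← Finset.sum_add_distrib]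
  refine Finset.sum_congr rfl fun c _ => Finset.sum_congr rfl fun a _ => ?_
  rw [row_eq_update, row_eq_update c a A B, row_eq_update c a A B', ← MultilinearMap.map_update_add]
  rfl

theorem tri_row_smul (f : Cochain k F G) (A B C : Cochain k E F) (r : k) :
    tri f (row A (r • B) C) = r • tri f (row A B C) := by
  ext n v
  simp only [Pi.smul_apply, smul_apply, tri_apply, Finset.smul_sum]
  refine Finset.sum_congr rfl fun c _ => Finset.sum_congr rfl fun a _ => ?_
  rw [row_eq_update, row_eq_update c a A B, ← MultilinearMap.map_update_smul]
  rfl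

theorem tri_row_sub (f : Cochain k F G) (A B B' C : Cochain k E F) :
    tri f (row A (B - B') C) = tri f (row A B C) - tri f (row A B' C) := by
  have : B - B' = B + (-1 : k) • B' := by
    rw [neg_one_smul, sub_eq_add_neg]
  rw [this, tri_row_add, tri_row_smul, neg_one_smul, sub_eq_add_neg]

theorem pack_sub {ι : Type*} (B B' : ι → Cochain k E F) : pack (B - B') = pack B - pack B' :=
  rfl

theorem dtri_row_sub (f : Cochain k F G) (A B B' C : Ordering → Cochain k E F) :
    dtri f (row A (B - B') C) = dtri f (row A B C) - dtri f (row A B' C) := by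
  have h : ∀ B, dtri f (row A B C) = tri (polar f) (row (pack A) (pack B) (pack C)) := by
    intro B
    rw [dtri]
    congr 1
    ext1 o
    exact comp_row pack A B C o
  rw [h, h, h, pack_sub, tri_row_sub]

/-- The finite difference formula. -/
theorem comp_sub_comp (f : Cochain k F G) (A C : Cochain k E F) :
    comp f A - comp f C = tri f (row A (A - C) C) := by
  ext n v
  simp only [Pi.sub_apply, sub_apply, comp_apply, tri_apply, ← Finset.sum_sub_distrib]
  refine Finset.sum_congr rfl fun c _ => ?_
  have h := (f c.length).map_piecewise_sub_map_piecewise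
    (fun i => A (c.blocksFun i) fun x => v (c.embedding i x))
    (fun i => C (c.blocksFun i) fun x => v (c.embedding i x)) 0 Finset.univ
  rw [Finset.piecewise_univ, Finset.piecewise_univ] at h
  rw [h]
  refine Finset.sum_congr rfl fun a _ => ?_
  congr 1
  ext i
  rcases lt_trichotomy i a with h | rfl | h
  · simp [h, h.cmp_eq_lt]
  · simp
  · simp [h.not_gt, h.ne', h.cmp_eq_gt]

/-- The finite difference formula between A and A + rB, where the factor r comes out of the middle
slot without any division. -/
theorem comp_add_smul (f : Cochain k F G) (A B : Cochain k E F) (r : k) :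
    comp f (A + r • B) = comp f A + r • tri f (row A B (A + r • B)) := by
  have h := comp_sub_comp f A (A + r • B)
  rw [show A - (A + r • B) = (-r) • B by rw [neg_smul]; abel, tri_row_smul, neg_smul,
    sub_eq_iff_eq_add] at h
  rw [h]
  abel

/-- If the two marks coincide, the entry is `B .eq = 0`. Otherwise the second marked block uses at
least one input, so `B` sees fewer than `n` of them. -/
theorem dtri_row_eq_zero (f : Cochain k F G) (A B C : Ordering → Cochain k E F) {n : ℕ}
    (hB : B .eq = 0) (hlt : ∀ o m, 1 ≤ m → m < n → B o m = 0) :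
    dtri f (row A B C) n = 0 := by
  ext v
  rw [dtri_apply]
  refine Finset.sum_eq_zero fun c _ => Finset.sum_eq_zero fun a _ =>
    Finset.sum_eq_zero fun a' _ => MultilinearMap.map_coord_zero _ a ?_
  rw [cmp_self_eq_eq, row_eq]
  rcases eq_or_ne a' a with rfl | h
  · rw [cmp_self_eq_eq, hB]
    rfl
  · rw [hlt _ _ (c.one_le_blocksFun a)]
    · rfl
    · have hs := Finset.add_le_sum (f := c.blocksFun) (s := Finset.univ) (fun _ _ => Nat.zero_le _)
        (Finset.mem_univ a') (Finset.mem_univ a) h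
      have := c.one_le_blocksFun a'
      rw [c.sum_blocksFun] at hs
      omega

end Linearity

/-! ### The two grid arguments: twisting b and twisting the Rota–Baxter equation. -/

section Core

variable {k V : Type*} [Field k] [AddCommGroup V] [Module k V]

theorem idCochain_zero : idCochain k V 0 = 0 := idCochain_of_ne zero_ne_one

theorem comp_add_smul_id_left (R f : Cochain k V V) (lam : k) (hf : f 0 = 0) :
    comp (R + lam • idCochain k V) f = comp R f + lam • f := by
  rw [comp_add_left, comp_smul_left, id_comp hf]

theorem tri_add_smul_id_left (R : Cochain k V V) (f : Ordering → Cochain k V V) (lam : k)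
    (hf : f .eq 0 = 0) :
    tri (R + lam • idCochain k V) f = tri R f + lam • f .eq := by
  rw [tri_add_left, tri_smul_left, id_tri hf]

theorem lin_comp_add_smul_id {R : Cochain k V V} {lam : k} {σ : V →ₗ[k] V} (hR0 : R 0 = 0)
    (hR : comp R (lin σ) = comp (lin σ) R) :
    comp (R + lam • idCochain k V) (lin σ) = comp (lin σ) (R + lam • idCochain k V) := by
  rw [comp_add_smul_id_left _ _ _ (lin_of_ne σ zero_ne_one), hR, lin_comp _ hR0, lin_comp]
  · ext n v
    simp [lin]
  · simp [hR0, idCochain_zero]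

/-- The twisted operation `bt = b⟨R, 1, R + lam⟩`. -/
theorem tri_twist_self {b R : Cochain k V V} {lam : k} {σ : V →ₗ[k] V} (hR0 : R 0 = 0)
    (hR : comp R (lin σ) = comp (lin σ) R)
    (hb : tri b (row (lin σ) b (idCochain k V)) = 0) {bt : Cochain k V V}
    (hbt : bt = tri b (row R (idCochain k V) (R + lam • idCochain k V)))
    (hRB : comp b R = tri R (row (lin σ) bt (idCochain k V))) :
    tri bt (row (lin σ) bt (idCochain k V)) = 0 := by
  have hP := lin_comp_add_smul_id (lam := lam) hR0 hR
  have hbt0 : bt 0 = 0 := hbt ▸ tri_zero_arity _ _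
  have hS0 : lin σ 0 = 0 := lin_of_ne σ zero_ne_one
  -- R + λ satisfies the same morphism equation as R: both sides change by λ·bt.
  have hcP : comp b (R + lam • idCochain k V) =
      tri (R + lam • idCochain k V) (row (lin σ) bt (idCochain k V)) := by
    rw [comp_add_smul, ← hbt, hRB, tri_add_smul_id_left _ _ _ hbt0, row_eq]
  set P := R + lam • idCochain k V with hPdef
  have hP0 : P 0 = 0 := by simp [hPdef, hR0, idCochain_zero]
  have hSP : tri (lin σ) (row R (idCochain k V) P) = lin σ := lin_tri_id σ rfl
  -- The relation b⟨σ,b,1⟩ = 0, evaluated on (R,1,P). Its transposed grid has rows (σR,σ,σP),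
  -- (b∘R,bt,b∘P), (R,1,P). The grid of the goal agrees with it because R and P commute with σ and
  -- both satisfy the morphism equation.
  have h1 := tri_tri b (row (lin σ) b (idCochain k V)) (row R (idCochain k V) P)
  rw [hb, tri_zero_left, dtri_swap] at h1
  nth_rewrite 1 [hbt]
  rw [tri_tri, h1]
  congr 1
  funext o o'
  cases o <;> cases o' <;>
    simp [hR, hP, ← hRB, ← hcP, ← hbt, id_comp, id_tri, comp_id, hSP, hR0, hP0, hbt0, hS0,
      idCochain_zero]

/-- The twisted structure is again a Rota-Baxter structure. -/
theorem comp_twist {b R : Cochain k V V} {lam : k} {σ : V →ₗ[k] V} {bt Rt btt : Cochain k V V}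
    (hRt : comp Rt (lin σ) = comp (lin σ) Rt)
    (hbt : bt = tri b (row R (idCochain k V) (R + lam • idCochain k V)))
    (hRtt : Rt = tri R (row Rt (idCochain k V) (Rt + lam • idCochain k V)))
    (hbtt : btt = tri bt (row Rt (idCochain k V) (Rt + lam • idCochain k V)))
    (hRB : comp b R = tri R (row (lin σ) bt (idCochain k V))) :
    comp bt Rt = tri Rt (row (lin σ) btt (idCochain k V)) := by
  have hRt0 : Rt 0 = 0 := hRtt ▸ tri_zero_arity _ _
  have hbt0 : bt 0 = 0 := hbt ▸ tri_zero_arity _ _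
  have hbtt0 : btt 0 = 0 := hbtt ▸ tri_zero_arity _ _
  have hP := lin_comp_add_smul_id (lam := lam) hRt0 hRt
  have hS0 : lin σ 0 = 0 := lin_of_ne σ zero_ne_one
  set e := comp bt Rt - tri Rt (row (lin σ) btt (idCochain k V)) with he
  set P := Rt + lam • idCochain k V with hPdef
  have hP0 : P 0 = 0 := by simp [hPdef, hRt0, idCochain_zero]
  have hSP : tri (lin σ) (row Rt (idCochain k V) P) = lin σ := lin_tri_id σ rfl
  -- The defect is the same for Rt and for Rt + λ, as both terms change by λ·btt.
  have heP : comp bt P - tri P (row (lin σ) btt (idCochain k V)) = e := by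
    rw [hPdef, comp_add_smul, ← hPdef, ← hbtt, hPdef, tri_add_smul_id_left _ _ _ hbtt0, row_eq, he]
    abel
  have h1 : comp bt Rt = dtri R (row (row (comp Rt (lin σ)) (lin σ) (comp P (lin σ)))
      (row (comp bt Rt) btt (comp bt P)) (row Rt (idCochain k V) P)) := by
    -- Both sides equal b⟨R∘Rt, Rt, R∘Rt + λRt⟩. The fixed point equation for Rt identifies the
    -- middle entry, and the finite difference formula identifies the last one.
    have h2 : comp bt Rt = tri (comp b R) (row Rt (idCochain k V) P) := by
      rw [tri_comp, row_lt, row_gt, ← hRtt, hPdef, comp_add_smul, ← hPdef, ← hRtt]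
      nth_rewrite 1 [hbt]
      rw [tri_comp_left]
      congr 1
      ext1 o
      cases o
      · rfl
      · exact id_comp hRt0
      · exact comp_add_smul_id_left _ _ _ hRt0
    refine h2.trans ?_
    rw [hRB, tri_tri, dtri_swap]
    congr 1
    funext o o'
    cases o <;> cases o' <;>
      simp [hRt, hP, ← hbtt, id_comp, id_tri, hSP, hRt0, hP0, idCochain_zero]
  have h2 : tri Rt (row (lin σ) btt (idCochain k V)) =
      dtri R (row (row (comp Rt (lin σ)) (lin σ) (comp P (lin σ)))
        (row (tri Rt (row (lin σ) btt (idCochain k V))) btt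
          (tri P (row (lin σ) btt (idCochain k V)))) (row Rt (idCochain k V) P)) := by
    nth_rewrite 1 [hRtt]
    rw [tri_tri]
    congr 1
    funext o o'
    cases o <;> cases o' <;>
      simp [id_comp, id_tri, comp_id, hS0, hbtt0]
  -- The grids of the two terms of e differ only in the middle row. There the centre entries are
  -- both btt and cancel, which leaves (e,0,e).
  have h3 : e = dtri R (row (row (comp Rt (lin σ)) (lin σ) (comp P (lin σ))) (row e 0 e)
      (row Rt (idCochain k V) P)) := by
    nth_rewrite 1 [he]
    nth_rewrite 1 [h1]
    nth_rewrite 1 [h2]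
    rw [← dtri_row_sub]
    congr 2
    funext o
    cases o
    · rfl
    · simp
    · exact heP
  suffices he0 : e = 0 from sub_eq_zero.1 he0
  funext n
  induction n using Nat.strong_induction_on with
  | _ n ih =>
    rw [h3]
    refine dtri_row_eq_zero _ _ _ _ rfl fun o m _ hm => ?_
    cases o
    · exact ih m hm
    · rfl
    · exact ih m hm

end Core

/-! ### Weighted sums over proper subsets of the inputs. -/

section Subsets

variable {k V W : Type*} [Field k] [AddCommGroup V] [Module k V] [AddCommGroup W] [Module k W]

theorem sum_orderEmbedding {M : Type*} [AddCommMonoid M] (p q : ℕ) (φ : Finset (Fin p) → M) :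
    ∑ e : Fin q ↪o Fin p, φ (Finset.univ.map e.toEmbedding) =
      ∑ s ∈ Finset.powersetCard q (Finset.univ : Finset (Fin p)), φ s := by
  refine Finset.sum_bij (fun e _ => Finset.univ.map e.toEmbedding) ?_ ?_ ?_ fun _ _ => rfl
  · intro e _
    simp [Finset.mem_powersetCard]
  · intro e _ e' _ h
    have hc : (Finset.univ.map e.toEmbedding).card = q := by simp
    rw [Finset.orderEmbOfFin_unique' hc (f := e) (by simp),
      Finset.orderEmbOfFin_unique' hc (f := e') (fun x => by rw [h]; simp)]
  · intro s hs
    have hc := (Finset.mem_powersetCard.1 hs).2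
    refine ⟨s.orderEmbOfFin hc, Finset.mem_univ _, ?_⟩
    simp

theorem sum_range_orderEmbedding {M : Type*} [AddCommMonoid M] [Module k M] (p : ℕ)
    (φ : Finset (Fin p) → M) (c : ℕ → k) :
    ∑ q ∈ Finset.range p, c q • ∑ e : Fin q ↪o Fin p, φ (Finset.univ.map e.toEmbedding) =
      ∑ s ∈ (Finset.univ : Finset (Finset (Fin p))).erase Finset.univ, c s.card • φ s := by
  rw [← Finset.sum_fiberwise_of_maps_to (t := Finset.range p) (g := Finset.card)]
  · refine Finset.sum_congr rfl fun q hq => ?_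
    rw [sum_orderEmbedding, Finset.smul_sum]
    refine Finset.sum_congr ?_ fun s hs => ?_
    · ext s
      simp only [Finset.mem_powersetCard, Finset.mem_filter, Finset.mem_erase, Finset.mem_univ,
        Finset.subset_univ, true_and, and_true]
      refine ⟨fun h => ⟨?_, h⟩, fun h => h.2⟩
      rintro rfl
      simp at h hq
      omega
    · rw [(Finset.mem_filter.1 hs).2]
  · intro s hs
    rw [Finset.mem_range]
    have := Finset.card_lt_card (Finset.ssubset_univ_iff.2 (Finset.mem_erase.1 hs).1)
    rwa [Finset.card_fin] at this

/-- Group the proper subsets by their least missing element a. Below a every input is x, at a it is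
y, and above a the choice is free. The exponent counts the y's above a, so the free choices sum to x
+ r·y in each of those slots. -/
theorem sum_map_piecewise {p : ℕ} (f : MultilinearMap k (fun _ : Fin p => V) W) (x y : Fin p → V)
    (r : k) :
    ∑ s ∈ (Finset.univ : Finset (Finset (Fin p))).erase Finset.univ,
        r ^ (p - s.card - 1) • f (s.piecewise x y) =
      ∑ a, f fun i => row (x i) (y i) (x i + r • y i) (cmp i a) := by
  have key : ∀ a : Fin p, (f fun i => row (x i) (y i) (x i + r • y i) (cmp i a)) =
      ∑ s ∈ (Finset.Ioi a).powerset,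
        r ^ (p - (s ∪ Finset.Iio a).card - 1) • f ((s ∪ Finset.Iio a).piecewise x y) := by
    intro a
    have h := f.map_piecewise_add x (fun i => row (x i) (y i) (r • y i) (cmp i a)) (Finset.Ioi a)
    have h' : (Finset.Ioi a).piecewise (x + fun i => row (x i) (y i) (r • y i) (cmp i a))
        (fun i => row (x i) (y i) (r • y i) (cmp i a)) =
        fun i => row (x i) (y i) (x i + r • y i) (cmp i a) := by
      ext i
      rcases lt_trichotomy i a with h | rfl | h
      · simp [h.cmp_eq_lt, h.not_gt]
      · simp
      · simp [h.cmp_eq_gt, h]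
    rw [← h', h]
    refine Finset.sum_congr rfl fun s hs => ?_
    rw [Finset.mem_powerset] at hs
    have hm := f.map_piecewise_smul (fun _ => r) ((s ∪ Finset.Iio a).piecewise x y)
      (Finset.Ioi a \ s)
    rw [Finset.prod_const] at hm
    have hc : (Finset.Ioi a \ s).card = p - (s ∪ Finset.Iio a).card - 1 := by
      have hd : Disjoint s (Finset.Iio a) :=
        (Finset.disjoint_left.2 fun i hi hi' =>
          (Finset.mem_Ioi.1 (hs hi)).not_gt (Finset.mem_Iio.1 hi'))
      rw [Finset.card_sdiff_of_subset hs, Finset.card_union_of_disjoint hd, Fin.card_Ioi,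
        Fin.card_Iio]
      omega
    rw [← hc, ← hm]
    congr 1
    ext i
    rcases lt_trichotomy i a with h | rfl | h
    · have : i ∉ s := fun hi => h.not_gt (Finset.mem_Ioi.1 (hs hi))
      simp [h.cmp_eq_lt, h, h.not_gt, this, Finset.piecewise]
    · have : i ∉ s := fun hi => lt_irrefl _ (Finset.mem_Ioi.1 (hs hi))
      simp [this, Finset.piecewise]
    · by_cases hi : i ∈ s <;> simp [h.cmp_eq_gt, h, h.not_gt, hi, Finset.piecewise]
  simp only [key, Finset.sum_sigma']
  symm
  refine Finset.sum_bij (fun z _ => z.2 ∪ Finset.Iio z.1) ?_ ?_ ?_ fun _ _ => rfl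
  · rintro ⟨a, s⟩ hs
    simp only [Finset.mem_sigma, Finset.mem_powerset] at hs
    refine Finset.mem_erase.2 ⟨fun h => ?_, Finset.mem_univ _⟩
    have : a ∈ s ∪ Finset.Iio a := h ▸ Finset.mem_univ a
    rcases Finset.mem_union.1 this with h | h
    · exact lt_irrefl _ (Finset.mem_Ioi.1 (hs.2 h))
    · exact lt_irrefl _ (Finset.mem_Iio.1 h)
  · rintro ⟨a, s⟩ hs ⟨a', s'⟩ hs' h
    simp only [Finset.mem_sigma, Finset.mem_powerset, Finset.mem_univ, true_and] at hs hs' h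
    have hmem : ∀ i, (i ∈ s ∨ i < a) ↔ (i ∈ s' ∨ i < a') := fun i => by
      simpa using congrArg (i ∈ ·) h
    have h1 : ∀ i ∈ s, a < i := fun i hi => Finset.mem_Ioi.1 (hs hi)
    have h2 : ∀ i ∈ s', a' < i := fun i hi => Finset.mem_Ioi.1 (hs' hi)
    obtain rfl : a = a' := by
      rcases lt_trichotomy a a' with h | h | h
      · rcases (hmem a).2 (.inr h) with h' | h'
        · exact absurd (h1 _ h') (lt_irrefl _)
        · exact absurd h' (lt_irrefl _)
      · exact h
      · rcases (hmem a').1 (.inr h) with h' | h'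
        · exact absurd (h2 _ h') (lt_irrefl _)
        · exact absurd h' (lt_irrefl _)
    congr 1
    ext i
    refine ⟨fun hi => ?_, fun hi => ?_⟩
    · exact ((hmem i).1 (.inl hi)).resolve_right (h1 i hi).not_gt
    · exact ((hmem i).2 (.inl hi)).resolve_right (h2 i hi).not_gt
  · intro S hS
    have hne : Sᶜ.Nonempty := by
      rw [Finset.nonempty_iff_ne_empty, Ne, Finset.compl_eq_empty_iff]
      exact (Finset.mem_erase.1 hS).1
    -- The least element outside S is the marked slot, and the part of S above it is the free
    -- choice.
    refine ⟨⟨Sᶜ.min' hne, S ∩ Finset.Ioi (Sᶜ.min' hne)⟩, by simp, ?_⟩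
    have hmin := Sᶜ.min'_mem hne
    have hle := fun i => Sᶜ.min'_le i
    simp only [Finset.mem_compl] at hmin hle
    ext i
    simp only [Finset.mem_union, Finset.mem_inter, Finset.mem_Ioi, Finset.mem_Iio]
    constructor
    · rintro (h | h)
      · exact h.1
      · by_contra hi
        exact (hle i hi).not_gt h
    · intro hi
      rcases lt_trichotomy (Sᶜ.min' hne) i with h | h | h
      · exact .inl ⟨hi, h⟩
      · exact absurd (h ▸ hi) hmin
      · exact .inr h

end Subsets

/-! ### Koszul signs and the translation of braces into marked insertions. -/

section Bridge

variable {k V W : Type*} [Field k] [AddCommGroup V] [Module k V] [AddCommGroup W] [Module k W]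
  (𝒱 : ℤ → Submodule k V) [DirectSum.Decomposition 𝒱]

theorem linearMap_ext_homogeneous {f g : V →ₗ[k] W} (h : ∀ i, ∀ v ∈ 𝒱 i, f v = g v) : f = g := by
  ext v
  induction v using DirectSum.Decomposition.inductionOn 𝒱 with
  | zero => simp
  | homogeneous v => exact h _ _ v.2
  | add v w hv hw => rw [map_add, map_add, hv, hw]

theorem koszul_zero : koszul 𝒱 0 = LinearMap.id := by
  refine linearMap_ext_homogeneous 𝒱 fun i v hv => ?_
  rw [koszul_apply_of_mem 𝒱 0 hv]
  simp

theorem koszul_koszul (d e : ℤ) (v : V) : koszul 𝒱 d (koszul 𝒱 e v) = koszul 𝒱 (d + e) v := by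
  suffices h : koszul 𝒱 d ∘ₗ koszul 𝒱 e = koszul 𝒱 (d + e) from LinearMap.congr_fun h v
  refine linearMap_ext_homogeneous 𝒱 fun i v hv => ?_
  rw [LinearMap.comp_apply, koszul_apply_of_mem 𝒱 e hv, map_smul, koszul_apply_of_mem 𝒱 d hv,
    koszul_apply_of_mem 𝒱 _ hv, smul_smul, add_mul, Int.negOnePow_add]
  push_cast
  rw [mul_comm]

theorem koszul_suspGrading (d : ℤ) (v : V) :
    koszul (suspGrading 𝒱) d v = ((d.negOnePow : ℤ) : k) • koszul 𝒱 d v := by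
  suffices h : koszul (suspGrading 𝒱) d = ((d.negOnePow : ℤ) : k) • koszul 𝒱 d from
    LinearMap.congr_fun h v
  refine linearMap_ext_homogeneous 𝒱 fun i v hv => ?_
  have hv' : v ∈ suspGrading 𝒱 (i + 1) := by
    simpa [suspGrading] using hv
  rw [LinearMap.smul_apply, koszul_apply_of_mem 𝒱 d hv, koszul_apply_of_mem _ d hv', smul_smul,
    mul_add, mul_one, Int.negOnePow_add]
  push_cast
  rw [mul_comm]

theorem compAll_eq_comp (f g : Cochain k V V) : compAll 𝒱 f g = comp f g := by
  ext n v
  rw [comp_apply, compAll, sum_apply]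
  refine Finset.sum_congr rfl fun c _ => ?_
  rw [koszulComp_apply]
  simp [koszul_zero]

theorem brace_zero_apply {q : ℕ} (f : Cochain k V W) (g : Fin q → Cochain k V V) (n : ℕ)
    (v : Fin n → V) :
    brace 𝒱 f g (fun _ => 0) n v = ∑ c : Composition n, ∑ e : Fin q ↪o Fin c.length,
      f c.length fun i => Function.extend e g (fun _ => idCochain k V) i (c.blocksFun i) fun x =>
        v (c.embedding i x) := by
  rw [brace, sum_apply]
  refine Finset.sum_congr rfl fun c _ => ?_
  rw [sum_apply]
  refine Finset.sum_congr rfl fun e _ => ?_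
  rw [koszulComp_apply]
  have h : Function.extend e (fun _ => (0 : ℤ)) (fun _ => 0) = fun _ => 0 := by
    ext i
    by_cases hi : ∃ j, e j = i
    · obtain ⟨j, rfl⟩ := hi
      rw [e.injective.extend_apply]
    · rw [Function.extend_apply' _ _ _ hi]
  simp [h, koszul_zero]

theorem idCochain_map (L : V →ₗ[k] V) (n : ℕ) (v : Fin n → V) :
    idCochain k V n (fun x => L (v x)) = L (idCochain k V n v) := by
  by_cases hn : n = 1
  · subst hn
    simp [idCochain_one_apply]
  · simp [idCochain_of_ne hn]

theorem extend_one {α : Type*} {m : ℕ} (e : Fin 1 ↪o Fin m) (x : α) (F : Fin m → α)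
    (i : Fin m) : Function.extend e (fun _ => x) F i = if i = e 0 then x else F i := by
  split_ifs with h
  · rw [h, e.injective.extend_apply]
  · rw [Function.extend_apply']
    rintro ⟨j, rfl⟩
    exact h (congrArg e (Subsingleton.elim _ _))

theorem brace_one_apply (f : Cochain k V W) (g : Cochain k V V) (d : ℤ) (n : ℕ) (v : Fin n → V) :
    brace 𝒱 f (fun _ : Fin 1 => g) (fun _ => d) n v =
      ∑ c : Composition n, ∑ a : Fin c.length, f c.length fun i =>
        (if i = a then g else idCochain k V) (c.blocksFun i) fun x =>
          koszul 𝒱 (if i < a then d else 0) (v (c.embedding i x)) := by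
  rw [brace, sum_apply]
  refine Finset.sum_congr rfl fun c _ => ?_
  rw [sum_apply]
  refine Fintype.sum_equiv
    ⟨fun e => e 0, fun a => OrderEmbedding.ofStrictMono (fun _ => a) (Subsingleton.strictMono _),
      fun e => ?_, fun a => rfl⟩ _ _ fun e => ?_
  · ext i
    rw [Subsingleton.elim i 0]
    rfl
  · rw [koszulComp_apply]
    simp [extend_one]
    rfl

/-- The operation g passes exactly the inputs to its left, so the Koszul rule puts its sign operator
there and the identity to its right. -/
theorem brace_one_eq_tri (f : Cochain k V W) (g : Cochain k V V) (d : ℤ) :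
    brace 𝒱 f (fun _ : Fin 1 => g) (fun _ => d) =
      tri f (row (lin (koszul 𝒱 d)) g (idCochain k V)) := by
  ext n v
  rw [brace_one_apply, tri_apply]
  refine Finset.sum_congr rfl fun c _ => Finset.sum_congr rfl fun a _ => ?_
  congr 1
  ext i
  rcases lt_trichotomy i a with h | rfl | h
  · rw [if_neg h.ne, if_pos h, h.cmp_eq_lt, row_lt, idCochain_map]
    rfl
  · simp [koszul_zero]
  · simp [h.ne', h.not_gt, h.cmp_eq_gt, koszul_zero]

theorem arityPart_of_ne (f : Cochain k V W) {p n : ℕ} (h : n ≠ p) : arityPart p f n = 0 :=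
  Pi.single_eq_of_ne h _

theorem arityPart_self (f : Cochain k V W) (p : ℕ) : arityPart p f p = f p :=
  Pi.single_eq_same p _

theorem brace_arityPart_of_lt {q p n : ℕ} (f : Cochain k V W) (g : Fin q → Cochain k V V)
    (h : n < p) : brace 𝒱 (arityPart p f) g (fun _ => 0) n = 0 := by
  ext v
  rw [brace_zero_apply]
  refine Finset.sum_eq_zero fun c _ => Finset.sum_eq_zero fun e _ => ?_
  rw [arityPart_of_ne]
  · rfl
  · have := c.length_le
    omega

/-- For a fixed cutting only p equal to the number of blocks contributes. The increasing choices of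
blocks for g are then the proper subsets weighed in `sum_map_piecewise`. -/
theorem sum_brace_eq_tri (f : Cochain k V W) (g : Cochain k V V) (r : k) (n : ℕ) :
    ∑ p ∈ Finset.Icc 1 n, ∑ q ∈ Finset.range p, r ^ (p - q - 1) •
      brace 𝒱 (arityPart p f) (fun _ : Fin q => g) (fun _ => 0) n =
    tri f (row g (idCochain k V) (g + r • idCochain k V)) n := by
  rcases Nat.eq_zero_or_pos n with rfl | hn
  · rw [tri_zero_arity]
    rfl
  ext v
  simp only [sum_apply, smul_apply, brace_zero_apply, tri_apply,
    Finset.smul_sum (s := Finset.univ (α := Composition n))]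
  have hswap : ∀ φ : ℕ → ℕ → Composition n → W, ∑ p ∈ Finset.Icc 1 n, ∑ q ∈ Finset.range p,
      ∑ c, φ p q c = ∑ c, ∑ p ∈ Finset.Icc 1 n, ∑ q ∈ Finset.range p, φ p q c := by
    intro φ
    symm
    rw [Finset.sum_comm]
    exact Finset.sum_congr rfl fun p _ => Finset.sum_comm
  rw [hswap]
  refine Finset.sum_congr rfl fun c _ => ?_
  rw [Finset.sum_eq_single c.length]
  · rw [arityPart_self]
    set x : Fin c.length → V := fun i => g (c.blocksFun i) fun x => v (c.embedding i x) with hx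
    set y : Fin c.length → V := fun i => idCochain k V (c.blocksFun i) fun x => v (c.embedding i x)
      with hy
    have h := sum_map_piecewise (f c.length) x y r
    rw [← sum_range_orderEmbedding c.length (fun s => f c.length (s.piecewise x y))
      (fun q => r ^ (c.length - q - 1))] at h
    refine Eq.trans ?_ (h.trans ?_)
    · refine Finset.sum_congr rfl fun q _ => ?_
      congr 1
      refine Finset.sum_congr rfl fun e _ => ?_
      congr 1
      ext i
      by_cases hi : ∃ j, e j = i
      · obtain ⟨j, rfl⟩ := hi
        rw [e.injective.extend_apply, Finset.piecewise_eq_of_mem _ _ _ (by simp)]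
      · rw [Function.extend_apply' _ _ _ hi, Finset.piecewise_eq_of_notMem]
        simpa using hi
    · refine Finset.sum_congr rfl fun a _ => ?_
      congr 1
      ext i
      cases cmp i a <;> rfl
  · intro p _ hp
    refine Finset.sum_eq_zero fun q _ => ?_
    rw [arityPart_of_ne f hp.symm]
    simp
  · intro h
    exact absurd (Finset.mem_Icc.2 ⟨c.length_pos_iff.2 hn, c.length_le⟩) h

theorem bTilde_eq_tri (b R : Cochain k V V) (r : k) (n : ℕ) :
    bTilde 𝒱 r b R n = tri b (row R (idCochain k V) (R + r • idCochain k V)) n :=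
  sum_brace_eq_tri _ _ _ _ _

/-- `tri` as a linear map of its middle argument. -/
noncomputable def triRow (f : Cochain k V W) (A C : Cochain k V V) :
    Cochain k V V →ₗ[k] Cochain k V W where
  toFun B := tri f (row A B C)
  map_add' B B' := tri_row_add f A B B' C
  map_smul' r B := tri_row_smul f A B C r

/-- The shift from q to q - 1 turns the weights of the Rota–Baxter equation into those of b̃, and
linearity in the middle slot moves the sum inside the outer brace. -/
theorem sum_brace_brace (b R : Cochain k V V) (r : k) (d : ℤ) (n : ℕ) :
    ∑ p ∈ Finset.Icc 1 n, ∑ q ∈ Finset.Icc 1 p, r ^ (p - q) •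
      brace (suspGrading 𝒱) R
        (fun _ : Fin 1 =>
          brace (suspGrading 𝒱) (arityPart p b) (fun _ : Fin (q - 1) => R) (fun _ => 0))
        (fun _ => d) n =
      tri R (row (lin (koszul (suspGrading 𝒱) d)) (bTilde 𝒱 r b R) (idCochain k V)) n := by
  set A := lin (koszul (suspGrading 𝒱) d)
  set C := idCochain k V
  let B : ℕ → ℕ → Cochain k V V := fun p q =>
    brace (suspGrading 𝒱) (arityPart p b) (fun _ : Fin q => R) (fun _ => 0)
  have h : ∀ p q : ℕ, brace (suspGrading 𝒱) R (fun _ : Fin 1 => B p q) (fun _ => d) =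
      triRow R A C (B p q) := fun p q => brace_one_eq_tri _ _ _ _
  have h1 : ∀ p, ∑ q ∈ Finset.Icc 1 p, r ^ (p - q) • triRow R A C (B p (q - 1)) =
      ∑ q ∈ Finset.range p, r ^ (p - q - 1) • triRow R A C (B p q) := by
    intro p
    rw [Finset.range_eq_Ico, Finset.sum_Ico_eq_sum_range]
    refine Finset.sum_bij' (fun q _ => q - 1) (fun q _ => q + 1) ?_ ?_ ?_ ?_ ?_
    · simp only [Finset.mem_Icc, Finset.mem_range]
      omega
    · simp only [Finset.mem_Icc, Finset.mem_range]
      omega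
    · simp only [Finset.mem_Icc]
      omega
    · simp
    · intro q hq
      rw [Finset.mem_Icc] at hq
      simp only [zero_add]
      rw [show p - (q - 1) - 1 = p - q by omega]
  have h2 : ∑ p ∈ Finset.Icc 1 n, ∑ q ∈ Finset.Icc 1 p, r ^ (p - q) • triRow R A C (B p (q - 1)) =
      triRow R A C (∑ p ∈ Finset.Icc 1 n, ∑ q ∈ Finset.range p, r ^ (p - q - 1) • B p q) := by
    rw [map_sum]
    refine Finset.sum_congr rfl fun p _ => ?_
    rw [h1, map_sum]
    exact Finset.sum_congr rfl fun q _ => (map_smul _ _ _).symm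
  have h3 := congrFun h2 n
  simp only [Finset.sum_apply, Pi.smul_apply] at h3
  simp only [B] at h
  simp only [h]
  refine h3.trans ?_
  change tri R (row A _ C) n = _
  -- The sum over p runs up to n here but only up to m in b̃_m. The extra terms have p > m and
  -- vanish, since p blocks need at least p inputs.
  refine tri_congr (fun _ _ _ => rfl) fun o m hm hmn => ?_
  cases o
  · rfl
  · simp only [row_eq, Finset.sum_apply, Pi.smul_apply, bTilde]
    symm
    refine Finset.sum_subset (Finset.Icc_subset_Icc_right hmn) fun p hp hp' =>
      Finset.sum_eq_zero fun q _ => ?_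
    have hmp : m < p := by
      rw [Finset.mem_Icc] at hp hp'
      omega
    exact (congrArg _ (brace_arityPart_of_lt _ _ _ hmp)).trans (smul_zero _)
  · rfl

end Bridge

/-! ### The fixed point equation for R̃. -/

section FixedPoint

variable {k V W : Type*} [Field k] [AddCommGroup V] [Module k V] [AddCommGroup W] [Module k W]
  (𝒱 : ℤ → Submodule k V) [DirectSum.Decomposition 𝒱]

theorem extend_update {α β : Type*} [DecidableEq α] {q : ℕ} {e : Fin q → α}
    (he : Function.Injective e) (g : Fin q → β) (F : α → β) (i : Fin q) (x : β) :
    Function.extend e (Function.update g i x) F =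
      Function.update (Function.extend e g F) (e i) x := by
  ext a
  by_cases ha : ∃ j, e j = a
  · obtain ⟨j, rfl⟩ := ha
    rw [he.extend_apply]
    by_cases hj : j = i
    · subst hj
      simp
    · rw [Function.update_of_ne hj, Function.update_of_ne (he.ne hj), he.extend_apply]
  · rw [Function.extend_apply' _ _ _ ha, Function.update_of_ne, Function.extend_apply' _ _ _ ha]
    rintro rfl
    exact ha ⟨i, rfl⟩

theorem update_eval {n : ℕ} (c : Composition n) (φ : Fin c.length → Cochain k V V)
    (j : Fin c.length) (x : Cochain k V V) (v : Fin n → V) :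
    (fun i => Function.update φ j x i (c.blocksFun i) fun y => v (c.embedding i y)) =
      Function.update (fun i => φ i (c.blocksFun i) fun y => v (c.embedding i y)) j
        (x (c.blocksFun j) fun y => v (c.embedding j y)) := by
  ext i
  rcases eq_or_ne i j with rfl | h
  · simp
  · simp [Function.update_of_ne h]

/-- The brace with operations of degree `0` is multilinear in these. -/
noncomputable def braceMultilinear (q : ℕ) (f : Cochain k V W) (n : ℕ) :
    MultilinearMap k (fun _ : Fin q => Cochain k V V) (MultilinearMap k (fun _ : Fin n => V) W) :=
  .mk' (fun g => brace 𝒱 f g (fun _ => 0) n)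
    (fun g i x y => by
      ext v
      simp only [add_apply, brace_zero_apply, ← Finset.sum_add_distrib]
      refine Finset.sum_congr rfl fun c _ => Finset.sum_congr rfl fun e _ => ?_
      simp only [extend_update e.injective, update_eval c _ _ _ v]
      exact MultilinearMap.map_update_add _ _ _ _ _)
    (fun g i r x => by
      ext v
      simp only [smul_apply, brace_zero_apply, Finset.smul_sum]
      refine Finset.sum_congr rfl fun c _ => Finset.sum_congr rfl fun e _ => ?_
      simp only [extend_update e.injective, update_eval c _ _ _ v]
      exact MultilinearMap.map_update_smul _ _ _ _ _)

theorem brace_sum (q : ℕ) (f : Cochain k V W) (n : ℕ) (s : Finset ℕ) (g : ℕ → Cochain k V V) :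
    brace 𝒱 f (fun _ : Fin q => ∑ j ∈ s, g j) (fun _ => 0) n =
      ∑ t ∈ Fintype.piFinset fun _ : Fin q => s, brace 𝒱 f (fun i => g (t i)) (fun _ => 0) n :=
  (braceMultilinear 𝒱 q f n).map_sum_finset (fun _ j => g j) fun _ => s

/-- Tuples in [1, m+1] with maximum m + 1 are those in the larger box but not in the box [1, m].
This turns the levels into differences. -/
theorem sum_max_eq {M : Type*} [AddCommGroup M] (q m : ℕ) (φ : (Fin q → ℕ) → M) :
    ∑ t : Fin q → Fin (m + 2) with (∀ i, 1 ≤ (t i : ℕ)) ∧ ∃ i, (t i : ℕ) = m + 1,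
        φ (fun i => t i) =
      ∑ t ∈ Fintype.piFinset fun _ : Fin q => Finset.Icc 1 (m + 1), φ t -
        ∑ t ∈ Fintype.piFinset fun _ : Fin q => Finset.Icc 1 m, φ t := by
  rw [← Finset.sum_sdiff_eq_sub]
  · refine Finset.sum_bij (fun t _ i => (t i : ℕ)) ?_ ?_ ?_ fun _ _ => rfl
    · intro t ht
      obtain ⟨-, h1, i, hi⟩ := Finset.mem_filter.1 ht
      simp only [Finset.mem_sdiff, Fintype.mem_piFinset, Finset.mem_Icc, not_forall]
      exact ⟨fun j => ⟨h1 j, by omega⟩, i, by omega⟩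
    · intro t _ t' _ h
      ext i
      exact congrFun h i
    · intro t ht
      simp only [Finset.mem_sdiff, Fintype.mem_piFinset, Finset.mem_Icc, not_forall] at ht
      obtain ⟨h1, i, hi⟩ := ht
      refine ⟨fun j => ⟨t j, by have := h1 j; omega⟩, ?_, rfl⟩
      rw [Finset.mem_filter]
      refine ⟨Finset.mem_univ _, fun j => (h1 j).1, i, ?_⟩
      have := h1 i
      change t i = m + 1
      omega
  · exact Fintype.piFinset_subset _ _ fun _ => Finset.Icc_subset_Icc_right (by omega)

/-- The partial sums of the families `R^j`. -/
noncomputable def RPartial (r : k) (R : Cochain k V V) (m : ℕ) : Cochain k V V :=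
  ∑ j ∈ Finset.Icc 1 m, RLevel 𝒱 r R j

theorem RLevel_add_two (r : k) (R : Cochain k V V) (m n : ℕ) :
    RLevel 𝒱 r R (m + 2) n =
      tri R (row (RPartial 𝒱 r R (m + 1)) (idCochain k V)
        (RPartial 𝒱 r R (m + 1) + r • idCochain k V)) n -
      tri R (row (RPartial 𝒱 r R m) (idCochain k V) (RPartial 𝒱 r R m + r • idCochain k V)) n := by
  rw [← sum_brace_eq_tri (suspGrading 𝒱), ← sum_brace_eq_tri (suspGrading 𝒱),
    ← Finset.sum_sub_distrib, RLevel]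
  refine Finset.sum_congr rfl fun p _ => ?_
  rw [← Finset.sum_sub_distrib]
  refine Eq.trans ?_ (Finset.sum_subset (s₁ := Finset.Icc 1 (p - 1)) ?_ ?_)
  · refine Finset.sum_congr rfl fun q _ => ?_
    rw [← smul_sub, RPartial, RPartial, brace_sum, brace_sum,
      ← sum_max_eq q m, Finset.smul_sum]
  · intro q hq
    rw [Finset.mem_Icc] at hq
    rw [Finset.mem_range]
    omega
  · intro q hq hq'
    rw [Finset.mem_Icc] at hq'
    -- The level omits q = 0, where no member of R^j is inserted, so the two terms of the difference
    -- coincide.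
    rw [Finset.mem_range] at hq
    obtain rfl : q = 0 := by omega
    rw [← smul_sub, Subsingleton.elim (fun _ : Fin 0 => RPartial 𝒱 r R (m + 1))
      (fun _ => RPartial 𝒱 r R m), sub_self, smul_zero]

theorem tri_row_zero (R : Cochain k V V) (r : k) {n : ℕ} (hn : 1 ≤ n) :
    tri R (row 0 (idCochain k V) (0 + r • idCochain k V)) n = r ^ (n - 1) • R n := by
  -- Composing with the identity writes both sides as sums over cuttings, which can be compared term
  -- by term.
  have h : r ^ (n - 1) • R n = comp (fun n => r ^ (n - 1) • R n) (idCochain k V) n := by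
    rw [comp_id]
  rw [h]
  ext v
  rw [tri_apply, comp_apply]
  refine Finset.sum_congr rfl fun c _ => ?_
  have hc : 0 < c.length := c.length_pos_iff.2 hn
  -- The entries before the mark are 0, so the mark must be on the first block. Each later block
  -- contributes a factor r.
  rw [Finset.sum_eq_single (⟨0, hc⟩ : Fin c.length)]
  · set y : Fin c.length → V := fun i => idCochain k V (c.blocksFun i) fun x => v (c.embedding i x)
      with hy
    have := (R c.length).map_piecewise_smul (fun _ => r) y (Finset.univ.erase ⟨0, hc⟩)
    rw [Finset.prod_const, Finset.card_erase_of_mem (Finset.mem_univ _), Finset.card_fin] at this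
    rw [smul_apply, ← this]
    congr 1
    ext i
    rcases Nat.eq_zero_or_pos (i : ℕ) with hi | hi
    · obtain rfl : i = ⟨0, hc⟩ := Fin.ext hi
      simp [hy]
    · have hlt : (⟨0, hc⟩ : Fin c.length) < i := hi
      rw [hlt.cmp_eq_gt, Finset.piecewise_eq_of_mem]
      · simp [hy]
      · simp [hlt.ne']
  · intro a _ ha
    refine MultilinearMap.map_coord_zero _ ⟨0, hc⟩ ?_
    have hlt : (⟨0, hc⟩ : Fin c.length) < a := by
      rw [Fin.lt_def]
      exact Nat.pos_of_ne_zero fun h => ha (Fin.ext h)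
    rw [hlt.cmp_eq_lt]
    rfl
  · simp

theorem RPartial_zero (r : k) (R : Cochain k V V) : RPartial 𝒱 r R 0 = 0 := by
  simp [RPartial]

/-- The differences in `RLevel_add_two` telescope, and R^1 is the value of the iteration at 0. -/
theorem RPartial_succ (r : k) (R : Cochain k V V) (m : ℕ) {n : ℕ} (hn : 1 ≤ n) :
    RPartial 𝒱 r R (m + 1) n = tri R (row (RPartial 𝒱 r R m) (idCochain k V)
      (RPartial 𝒱 r R m + r • idCochain k V)) n := by
  induction m with
  | zero =>
    rw [RPartial_zero, tri_row_zero R r hn]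
    simp [RPartial, RLevel]
  | succ m ih =>
    have h : RPartial 𝒱 r R (m + 1 + 1) n = RPartial 𝒱 r R (m + 1) n + RLevel 𝒱 r R (m + 2) n := by
      rw [RPartial, Finset.sum_Icc_succ_top (by omega)]
      rfl
    rw [h, RLevel_add_two, ih]
    abel

theorem RPartial_eq_RTilde (r : k) (R : Cochain k V V) {m n : ℕ} (hn : 1 ≤ n) (hm : n ≤ m) :
    RPartial 𝒱 r R m n = RTilde 𝒱 r R n := by
  rw [RPartial, RTilde, Finset.sum_apply]
  symm
  refine Finset.sum_subset (Finset.Icc_subset_Icc_right hm) fun j hj hj' => ?_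
  refine RLevel_eq_zero 𝒱 r R n j hn ?_
  rw [Finset.mem_Icc] at hj hj'
  omega

theorem RTilde_eq_tri (r : k) (R : Cochain k V V) :
    RTilde 𝒱 r R = tri R (row (RTilde 𝒱 r R) (idCochain k V)
      (RTilde 𝒱 r R + r • idCochain k V)) := by
  funext n
  rcases Nat.eq_zero_or_pos n with rfl | hn
  · rw [tri_zero_arity]
    rfl
  -- The partial sum of index n + 1 is expressed through the one of index n, which already agrees
  -- with R̃ in all positive arities up to n.
  rw [← RPartial_eq_RTilde 𝒱 r R hn (Nat.le_succ n), RPartial_succ 𝒱 r R n hn]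
  refine tri_congr (fun _ _ _ => rfl) fun o m hm hmn => ?_
  have := RPartial_eq_RTilde 𝒱 r R hm hmn
  cases o
  · exact this
  · rfl
  · exact congrArg (· + (r • idCochain k V) m) this

end FixedPoint

/-! ### Degrees, and how homogeneous maps commute with sign operators. -/

section Homogeneous

variable {k V W : Type*} [Field k] [AddCommGroup V] [Module k V] [AddCommGroup W] [Module k W]
  {𝒱 : ℤ → Submodule k V} {𝒲 : ℤ → Submodule k W}

theorem IsHomogeneous.add {n : ℕ} {f g : MultilinearMap k (fun _ : Fin n => V) W} {d : ℤ}
    (hf : IsHomogeneous 𝒱 𝒲 f d) (hg : IsHomogeneous 𝒱 𝒲 g d) : IsHomogeneous 𝒱 𝒲 (f + g) d :=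
  fun e v hv => add_mem (hf e v hv) (hg e v hv)

theorem IsHomogeneous.smul {n : ℕ} {f : MultilinearMap k (fun _ : Fin n => V) W} {d : ℤ}
    (hf : IsHomogeneous 𝒱 𝒲 f d) (r : k) : IsHomogeneous 𝒱 𝒲 (r • f) d :=
  fun e v hv => Submodule.smul_mem _ r (hf e v hv)

theorem isHomogeneous_zero (n : ℕ) (d : ℤ) :
    IsHomogeneous 𝒱 𝒲 (0 : MultilinearMap k (fun _ : Fin n => V) W) d :=
  fun _ _ _ => zero_mem _

theorem isHomogeneous_idCochain (n : ℕ) : IsHomogeneous 𝒱 𝒱 (idCochain k V n) 0 := by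
  by_cases hn : n = 1
  · subst hn
    intro e v hv
    simpa [idCochain_one_apply] using hv 0
  · rw [idCochain_of_ne hn]
    exact isHomogeneous_zero n 0

theorem IsHomogeneous.tri {f : Cochain k V W} {g : Ordering → Cochain k V V} {d : ℤ}
    (hf : ∀ n, 1 ≤ n → IsHomogeneous 𝒱 𝒲 (f n) d)
    (hg : ∀ o n, 1 ≤ n → IsHomogeneous 𝒱 𝒱 (g o n) 0) (n : ℕ) :
    IsHomogeneous 𝒱 𝒲 (tri f g n) d := by
  intro e v hv
  rw [tri_apply]
  refine sum_mem fun c _ => sum_mem fun a _ => ?_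
  have h := hf c.length a.pos (fun i => ∑ x, e (c.embedding i x))
    (fun i => g (cmp i a) (c.blocksFun i) fun x => v (c.embedding i x)) fun i => by
      have := hg (cmp i a) _ (c.one_le_blocksFun i) (fun x => e (c.embedding i x))
        (fun x => v (c.embedding i x)) fun x => hv _
      rwa [add_zero] at this
  have hs : ∑ i, ∑ x, e (c.embedding i x) = ∑ i, e i := by
    rw [← c.blocksFinEquiv.sum_comp, Fintype.sum_sigma]
    rfl
  rwa [hs] at h

theorem IsHomogeneous.tri_row {f : Cochain k V W} {g : Cochain k V V} {d : ℤ} (r : k)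
    (hf : ∀ n, 1 ≤ n → IsHomogeneous 𝒱 𝒲 (f n) d)
    (hg : ∀ n, 1 ≤ n → IsHomogeneous 𝒱 𝒱 (g n) 0) (n : ℕ) :
    IsHomogeneous 𝒱 𝒲 (HomotopyRB.tri f (row g (idCochain k V) (g + r • idCochain k V)) n) d := by
  refine .tri hf (fun o m hm => ?_) n
  cases o
  · exact hg m hm
  · exact isHomogeneous_idCochain m
  · exact (hg m hm).add ((isHomogeneous_idCochain m).smul r)

theorem isHomogeneous_suspGrading_iff {n : ℕ} {𝒰 : ℤ → Submodule k W}
    {f : MultilinearMap k (fun _ : Fin n => V) W} {d : ℤ} :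
    IsHomogeneous 𝒱 (suspGrading 𝒰) f d ↔ IsHomogeneous 𝒱 𝒰 f (d - 1) := by
  simp only [IsHomogeneous, suspGrading, add_sub_assoc]

variable (𝒱) [DirectSum.Decomposition 𝒱]

theorem koszul_mem (d : ℤ) {i : ℤ} {v : V} (hv : v ∈ 𝒱 i) : koszul 𝒱 d v ∈ 𝒱 i := by
  rw [koszul_apply_of_mem 𝒱 d hv]
  exact Submodule.smul_mem _ _ hv

theorem multilinearMap_ext_homogeneous {n : ℕ} {f g : MultilinearMap k (fun _ : Fin n => V) W}
    (h : ∀ (e : Fin n → ℤ) (v : Fin n → V), (∀ i, v i ∈ 𝒱 (e i)) → f v = g v) : f = g := by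
  classical
  ext v
  have hv : v = fun i => ∑ j ∈ (DirectSum.decompose 𝒱 (v i)).support,
      (DirectSum.decompose 𝒱 (v i) j : V) := by
    ext i
    exact (DirectSum.sum_support_decompose 𝒱 (v i)).symm
  rw [hv, MultilinearMap.map_sum_finset, MultilinearMap.map_sum_finset]
  exact Finset.sum_congr rfl fun r _ => h r _ fun i => Subtype.property _

theorem IsHomogeneous.koszul_apply [DirectSum.Decomposition 𝒲] {n : ℕ}
    {f : MultilinearMap k (fun _ : Fin n => V) W} {d : ℤ} (hf : IsHomogeneous 𝒱 𝒲 f d) (e : ℤ)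
    (v : Fin n → V) :
    koszul 𝒲 e (f v) = (((e * d).negOnePow : ℤ) : k) • f fun i => koszul 𝒱 e (v i) := by
  suffices h : (koszul 𝒲 e).compMultilinearMap f =
      (((e * d).negOnePow : ℤ) : k) • f.compLinearMap fun _ => koszul 𝒱 e from
    DFunLike.congr_fun h v
  refine multilinearMap_ext_homogeneous 𝒱 fun a v hv => ?_
  have h1 : (fun i => koszul 𝒱 e (v i)) = fun i => (((e * a i).negOnePow : ℤ) : k) • v i := by
    ext i
    exact koszul_apply_of_mem 𝒱 e (hv i)
  have h2 : ∏ i, (((e * a i).negOnePow : ℤ) : k) = (((e * ∑ i, a i).negOnePow : ℤ) : k) := by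
    rw [Finset.mul_sum]
    generalize (Finset.univ : Finset (Fin n)) = s
    induction s using Finset.induction_on with
    | empty => simp
    | insert i s hi ih =>
      rw [Finset.prod_insert hi, ih, Finset.sum_insert hi, Int.negOnePow_add]
      push_cast
      rfl
  rw [LinearMap.compMultilinearMap_apply, koszul_apply_of_mem 𝒲 e (hf a v hv), smul_apply,
    MultilinearMap.compLinearMap_apply, h1, MultilinearMap.map_smul_univ, h2, smul_smul, mul_add,
    Int.negOnePow_add]
  push_cast
  rw [mul_comm]

theorem IsHomogeneous.comp_koszul {f : Cochain k V V}
    (hf : ∀ n, 1 ≤ n → IsHomogeneous 𝒱 𝒱 (f n) 0) (hf0 : f 0 = 0) (e : ℤ) :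
    comp f (lin (koszul 𝒱 e)) = comp (lin (koszul 𝒱 e)) f := by
  ext n v
  rw [comp_lin, lin_comp _ hf0, LinearMap.compMultilinearMap_apply]
  rcases Nat.eq_zero_or_pos n with rfl | hn
  · simp [hf0]
  · rw [IsHomogeneous.koszul_apply 𝒱 (hf n hn)]
    simp

theorem IsHomogeneous.desuspend {f : Cochain k V W} {n : ℕ} {d : ℤ}
    (hf : IsHomogeneous (suspGrading 𝒱) 𝒲 (f n) d) :
    IsHomogeneous 𝒱 𝒲 (desuspend 𝒱 f n) (n + d) := by
  intro e v hv
  have h := hf (fun i => e i + 1) (fun i => koszul 𝒱 ((n : ℤ) - 1 - (i : ℕ)) (v i)) fun i => by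
    have := koszul_mem 𝒱 ((n : ℤ) - 1 - (i : ℕ)) (hv i)
    simpa [suspGrading] using this
  rw [Finset.sum_add_distrib, Finset.sum_const, Finset.card_fin, nsmul_one, add_assoc] at h
  exact h

theorem suspend_desuspend (f : Cochain k V W) : suspend 𝒱 (desuspend 𝒱 f) = f := by
  ext n v
  simp only [suspend, HomotopyRB.desuspend, MultilinearMap.compLinearMap_apply, koszul_koszul]
  congr 1
  ext i
  refine linearMap_ext_homogeneous 𝒱 (g := LinearMap.id) (fun j w hw => ?_) |>
    fun h => LinearMap.congr_fun h (v i)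
  rw [koszul_apply_of_mem 𝒱 _ hw, add_mul, Int.negOnePow_add, Int.units_mul_self]
  simp

end Homogeneous

/-! ### From the suspended relations to the signed Stasheff identities. -/

section Stasheff

variable {k V : Type*} [Field k] [AddCommGroup V] [Module k V]
  (𝒱 : ℤ → Submodule k V) [DirectSum.Decomposition 𝒱]

theorem sizeUpTo_of_blocksFun_eq_one {n : ℕ} (c : Composition n) (a : Fin c.length)
    (h : ∀ i, i ≠ a → c.blocksFun i = 1) (i : ℕ) (hi : i ≤ c.length) :
    c.sizeUpTo i + (if (a : ℕ) < i then 1 else 0) =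
      i + if (a : ℕ) < i then c.blocksFun a else 0 := by
  induction i with
  | zero => simp
  | succ i ih =>
    have ih := ih (by omega)
    have hs := c.sizeUpTo_succ' ⟨i, hi⟩
    simp only at hs
    rw [hs]
    by_cases hia : i = a
    · have : (⟨i, hi⟩ : Fin c.length) = a := Fin.ext hia
      rw [this]
      split_ifs at * <;> omega
    · rw [h ⟨i, hi⟩ fun h => hia (congrArg Fin.val h)]
      split_ifs at * <;> omega

/-- On sV, b has degree -1. Passing to the grading of V costs one factor (-1)^e per input and one
for the output, and the latter cancels the sign from the degree of b. -/
theorem koszul_desuspend {b : Cochain k V V} {n : ℕ}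
    (hb : IsHomogeneous (suspGrading 𝒱) (suspGrading 𝒱) (b n) (-1)) (e : ℕ) (v : Fin n → V) :
    koszul 𝒱 e (b n v) = (-1 : k) ^ (n * e) • b n fun i => koszul 𝒱 e (v i) := by
  have h := IsHomogeneous.koszul_apply (suspGrading 𝒱) hb e v
  simp only [koszul_suspGrading] at h
  rw [MultilinearMap.map_smul_univ, Finset.prod_const, Finset.card_fin, smul_smul] at h
  have hs : ((((e : ℤ).negOnePow : ℤˣ) : ℤ) : k) = (-1) ^ e := by
    rw [Int.negOnePow_def]
    simp
  have hs' : (((((e : ℤ) * -1).negOnePow : ℤˣ) : ℤ) : k) = (-1) ^ e := by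
    rw [mul_neg_one, Int.negOnePow_neg, hs]
  rw [hs, hs'] at h
  have h2 := congrArg (fun x => (-1 : k) ^ e • x) h
  simp only [smul_smul] at h2
  have h3 : (-1 : k) ^ e * (-1) ^ e = 1 := by
    rw [← mul_pow]
    simp
  rw [← mul_assoc, h3, one_smul, one_mul, ← pow_mul, mul_comm e n] at h2
  exact h2

theorem prod_sign {n : ℕ} (a : Fin n) (s : k) :
    ∏ i, (if i < a then -1 else if i = a then s else 1) = (-1) ^ (a : ℕ) * s := by
  have h : ∀ i, (if i < a then (-1 : k) else if i = a then s else 1) =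
      (if i < a then -1 else 1) * if i = a then s else 1 := by
    intro i
    rcases lt_trichotomy i a with h | rfl | h
    · simp [h, h.ne]
    · simp
    · simp [h.not_gt]
  simp only [h, Finset.prod_mul_distrib, Finset.prod_ite_eq', Finset.mem_univ, if_true]
  rw [Finset.prod_ite, Finset.prod_const, Finset.prod_const_one, mul_one]
  rw [show (Finset.univ.filter fun i => i < a) = Finset.Iio a by ext; simp, Fin.card_Iio]

theorem stasheff_eq_desuspend_brace {b : Cochain k V V}
    (hb : ∀ n, 1 ≤ n → IsHomogeneous (suspGrading 𝒱) (suspGrading 𝒱) (b n) (-1)) (n : ℕ) :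
    ∑ c : Composition n, ∑ a : Fin c.length,
      (-1 : k) ^ ((a : ℕ) + c.blocksFun a * (c.length - 1 - (a : ℕ))) •
        koszulComp 𝒱 c (desuspend 𝒱 b c.length)
          (fun x => if x = a then desuspend 𝒱 b (c.blocksFun x) else idCochain k V (c.blocksFun x))
          (fun x => if x = a then (c.blocksFun x : ℤ) - 2 else 0) =
      desuspend 𝒱 (brace (suspGrading 𝒱) b (fun _ : Fin 1 => b) (fun _ => -1)) n := by
  ext v
  rw [sum_apply, desuspend, MultilinearMap.compLinearMap_apply, brace_one_apply]
  refine Finset.sum_congr rfl fun c _ => ?_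
  rw [sum_apply]
  refine Finset.sum_congr rfl fun a _ => ?_
  rw [smul_apply, koszulComp_apply]
  -- If an unmarked block has size other than one, the identity family vanishes on it and both sides
  -- are zero.
  by_cases h : ∀ i, i ≠ a → c.blocksFun i = 1
  swap
  · push Not at h
    obtain ⟨i, hi, hi1⟩ := h
    rw [MultilinearMap.map_coord_zero _ i, MultilinearMap.map_coord_zero _ i, smul_zero]
    · rw [if_neg hi, idCochain_of_ne hi1]
      rfl
    · rw [if_neg hi, idCochain_of_ne hi1]
      rfl
  have hsize := sizeUpTo_of_blocksFun_eq_one c a h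
  have hn := hsize c.length le_rfl
  rw [c.sizeUpTo_length, if_pos a.2, if_pos a.2] at hn
  -- The input signs on the two sides agree block by block up to scalars: -1 for each block left of
  -- a, from comparing the gradings of V and sV, and (-1)^{jk} at a, where j is the size of block a
  -- and k the number of blocks to its right.
  have hterm : ∀ i : Fin c.length, koszul 𝒱 ((c.length : ℤ) - 1 - (i : ℕ))
      ((if i = a then desuspend 𝒱 b (c.blocksFun i) else idCochain k V (c.blocksFun i)) fun x =>
        koszul 𝒱 (∑ j ∈ Finset.Ioi i, if j = a then (c.blocksFun j : ℤ) - 2 else 0)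
          (v (c.embedding i x))) =
      (if i < a then (-1 : k) else if i = a then
        (-1) ^ (c.blocksFun a * (c.length - 1 - (a : ℕ))) else 1) •
      (if i = a then b else idCochain k V) (c.blocksFun i) fun x =>
        koszul (suspGrading 𝒱) (if i < a then -1 else 0)
          (koszul 𝒱 ((n : ℤ) - 1 - (c.embedding i x : ℕ)) (v (c.embedding i x))) := by
    intro i
    have hsi := hsize i i.2.le
    have hi2 := i.2
    have ha2 := a.2
    rw [Finset.sum_ite_eq']
    rcases lt_trichotomy i a with hia | rfl | hia
    · have hia' : (i : ℕ) < a := hia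
      rw [if_neg hia.ne, if_pos hia, if_pos hia, if_pos (Finset.mem_Ioi.2 hia), if_neg hia.ne,
        ← idCochain_map]
      rw [if_neg (by omega), if_neg (by omega)] at hsi
      have hm := h i hia.ne
      have hw : (fun x => koszul (suspGrading 𝒱) (-1)
          (koszul 𝒱 ((n : ℤ) - 1 - (c.embedding i x : ℕ)) (v (c.embedding i x)))) =
          fun x => ((-1 : k) • LinearMap.id (R := k) (M := V))
            (koszul 𝒱 ((c.length : ℤ) - 1 - (i : ℕ)) (koszul 𝒱 ((c.blocksFun a : ℤ) - 2) (v (c.embedding i x)))) := by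
        ext x
        have hx := x.2
        rw [koszul_koszul, koszul_suspGrading, koszul_koszul, LinearMap.smul_apply,
          LinearMap.id_apply, Int.negOnePow_neg, Int.negOnePow_one]
        push_cast
        congr 3
        rw [Composition.coe_embedding]
        omega
      rw [hw, idCochain_map ((-1 : k) • LinearMap.id)]
      simp
    · rw [if_pos rfl, if_neg (lt_irrefl _), if_pos rfl, if_neg (by simp), if_neg (lt_irrefl _),
        if_pos rfl, desuspend, MultilinearMap.compLinearMap_apply]
      rw [if_neg (by omega), if_neg (by omega)] at hsi
      have he : ((c.length : ℤ) - 1 - (i : ℕ)) = ((c.length - 1 - i : ℕ) : ℤ) := by omega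
      rw [he, koszul_desuspend 𝒱 (hb _ (c.one_le_blocksFun i))]
      congr 2
      ext x
      simp only [koszul_zero, LinearMap.id_apply, koszul_koszul]
      congr 2
      rw [Composition.coe_embedding]
      omega
    · have hia' : (a : ℕ) < i := hia
      rw [if_neg hia.ne', if_neg hia.not_gt, if_neg (by simp [hia.le]), if_neg hia.not_gt,
        if_neg hia.ne', if_neg hia.ne', one_smul, ← idCochain_map]
      rw [if_pos (by omega), if_pos (by omega)] at hsi
      congr 1
      ext x
      simp only [koszul_zero, LinearMap.id_apply]
      congr 2
      have := x.2
      have := h i hia.ne'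
      rw [Composition.coe_embedding]
      omega
  rw [desuspend, MultilinearMap.compLinearMap_apply]
  simp only [hterm]
  -- The collected scalars give (-1)^{i+jk}, the Stasheff sign itself, so the two cancel.
  rw [MultilinearMap.map_smul_univ, prod_sign, ← pow_add, smul_smul, ← mul_pow]
  simp

theorem isAInfinityAlgebra_desuspend {b : Cochain k V V}
    (hb : ∀ n, 1 ≤ n → IsHomogeneous (suspGrading 𝒱) (suspGrading 𝒱) (b n) (-1))
    (h : ∀ n, 1 ≤ n → brace (suspGrading 𝒱) b (fun _ : Fin 1 => b) (fun _ => -1) n = 0) :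
    IsAInfinityAlgebra 𝒱 (desuspend 𝒱 b) where
  degree n hn := by
    have := IsHomogeneous.desuspend 𝒱 (isHomogeneous_suspGrading_iff.1 (hb n hn))
    rwa [show (n : ℤ) + (-1 - 1) = n - 2 by ring] at this
  stasheff n hn := by
    rw [stasheff_eq_desuspend_brace 𝒱 hb, desuspend, h n hn]
    rfl

end Stasheff

/-! ### Normalisation in arity 0 and assembly of the results. -/

section Main

variable {k V W : Type*} [Field k] [AddCommGroup V] [Module k V] [AddCommGroup W] [Module k W]

/-- A family with its irrelevant member of arity `0` replaced by `0`. -/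
def reduce (f : Cochain k V W) : Cochain k V W := Function.update f 0 0

theorem reduce_zero (f : Cochain k V W) : reduce f 0 = 0 := Function.update_self _ _ _

theorem reduce_of_pos (f : Cochain k V W) {n : ℕ} (hn : 1 ≤ n) : reduce f n = f n :=
  Function.update_of_ne (by omega) _ _

/-- The grid arguments need identities of whole families, such as `id_comp`, which require the
member of arity 0 to vanish. Marked insertions never look at that member, so it may be set to 0. -/
theorem bTilde_eq_tri_reduce (𝒱 : ℤ → Submodule k V) [DirectSum.Decomposition 𝒱]
    (b R : Cochain k V V) (r : k) :
    bTilde 𝒱 r b R = tri (reduce b)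
      (row (reduce R) (idCochain k V) (reduce R + r • idCochain k V)) := by
  funext n
  rw [bTilde_eq_tri]
  refine tri_congr (fun m hm _ => (reduce_of_pos b hm).symm) fun o m hm _ => ?_
  cases o
  · exact (reduce_of_pos R hm).symm
  · rfl
  · exact congrArg (· + (r • idCochain k V) m) (reduce_of_pos R hm).symm

theorem RTilde_eq_tri_reduce (𝒱 : ℤ → Submodule k V) [DirectSum.Decomposition 𝒱]
    (R : Cochain k V V) (r : k) :
    RTilde 𝒱 r R = tri (reduce R)
      (row (RTilde 𝒱 r R) (idCochain k V) (RTilde 𝒱 r R + r • idCochain k V)) := by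
  nth_rewrite 1 [RTilde_eq_tri]
  funext n
  exact tri_congr (fun m hm _ => (reduce_of_pos R hm).symm) fun _ _ _ _ => rfl

/-- The Rota-Baxter identity as an identity of families. -/
theorem IsHomotopyRotaBaxter.comp_eq_tri {𝒱 : ℤ → Submodule k V} [DirectSum.Decomposition 𝒱]
    {r : k} {b R : Cochain k V V} (h : IsHomotopyRotaBaxter 𝒱 r b R) :
    comp (reduce b) (reduce R) =
      tri (reduce R) (row (lin (koszul (suspGrading 𝒱) (-1))) (bTilde 𝒱 r b R)
        (idCochain k V)) := by
  funext n
  rcases Nat.eq_zero_or_pos n with rfl | hn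
  · rw [tri_zero_arity, comp_zero_arity (reduce_zero b)]
  · have := h.rotaBaxter n hn
    rw [sum_brace_brace, compAll_eq_comp] at this
    rw [comp_congr hn (fun m hm _ => reduce_of_pos b hm) fun m hm _ => reduce_of_pos R hm, this]
    exact tri_congr (fun m hm _ => (reduce_of_pos R hm).symm) fun _ _ _ _ => rfl

theorem isHomogeneous_RPartial (𝒱 : ℤ → Submodule k V) [DirectSum.Decomposition 𝒱] (r : k)
    {R : Cochain k V V}
    (hR : ∀ n, 1 ≤ n → IsHomogeneous (suspGrading 𝒱) (suspGrading 𝒱) (R n) 0) (m n : ℕ)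
    (hn : 1 ≤ n) :
    IsHomogeneous (suspGrading 𝒱) (suspGrading 𝒱) (RPartial 𝒱 r R m n) 0 := by
  induction m generalizing n with
  | zero =>
    rw [RPartial_zero]
    exact isHomogeneous_zero n 0
  | succ m ih =>
    rw [RPartial_succ 𝒱 r R m hn]
    exact .tri_row r hR ih n

end Main

end HomotopyRB

open HomotopyRB in
theorem mainTheorem7 {k V : Type*} [Field k] [CharZero k] [AddCommGroup V] [Module k V]
    (𝒱 : ℤ → Submodule k V) [DirectSum.Decomposition 𝒱] (lam : k)
    (b R : HomotopyRB.Cochain k V V) (h : HomotopyRB.IsHomotopyRotaBaxter 𝒱 lam b R) :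
    HomotopyRB.IsAInfinityAlgebra 𝒱
        (HomotopyRB.desuspend 𝒱 (HomotopyRB.bTilde 𝒱 lam b R)) ∧
      HomotopyRB.IsAInfinityMorphism 𝒱 𝒱
        (HomotopyRB.desuspend 𝒱 (HomotopyRB.bTilde 𝒱 lam b R))
        (HomotopyRB.desuspend 𝒱 b) (HomotopyRB.desuspend 𝒱 R) ∧
      HomotopyRB.IsHomotopyRotaBaxter 𝒱 lam
        (HomotopyRB.bTilde 𝒱 lam b R) (HomotopyRB.RTilde 𝒱 lam R) := by
  have hRdeg : ∀ n, 1 ≤ n → IsHomogeneous (suspGrading 𝒱) (suspGrading 𝒱) (R n) 0 :=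
    fun n hn => isHomogeneous_suspGrading_iff.2 (h.degree_R n hn)
  have hbtdeg : ∀ n, 1 ≤ n →
      IsHomogeneous (suspGrading 𝒱) (suspGrading 𝒱) (bTilde 𝒱 lam b R n) (-1) := by
    intro n _
    rw [bTilde_eq_tri]
    exact .tri_row lam h.degree_b hRdeg n
  have hRtdeg : ∀ n, 1 ≤ n →
      IsHomogeneous (suspGrading 𝒱) (suspGrading 𝒱) (RTilde 𝒱 lam R n) 0 := by
    intro n hn
    rw [← RPartial_eq_RTilde 𝒱 lam R hn le_rfl]
    exact isHomogeneous_RPartial 𝒱 lam hRdeg n n hn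
  have hRdeg' : ∀ n, 1 ≤ n → IsHomogeneous (suspGrading 𝒱) (suspGrading 𝒱) (reduce R n) 0 :=
    fun n hn => reduce_of_pos R hn ▸ hRdeg n hn
  have hRS := IsHomogeneous.comp_koszul (suspGrading 𝒱) hRdeg' (reduce_zero R) (-1)
  have hRtS := IsHomogeneous.comp_koszul (suspGrading 𝒱) hRtdeg rfl (-1)
  have hb : tri (reduce b) (row (lin (koszul (suspGrading 𝒱) (-1))) (reduce b) (idCochain k V)) =
      0 := by
    funext n
    rcases Nat.eq_zero_or_pos n with rfl | hn
    · exact tri_zero_arity _ _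
    · refine Eq.trans ?_ (h.ainfinity n hn)
      rw [brace_one_eq_tri]
      refine tri_congr (fun m hm _ => reduce_of_pos b hm) fun o m hm _ => ?_
      cases o
      · rfl
      · exact reduce_of_pos b hm
      · rfl
  have hbt := bTilde_eq_tri_reduce 𝒱 b R lam
  have hsq : ∀ n, 1 ≤ n → brace (suspGrading 𝒱) (bTilde 𝒱 lam b R)
      (fun _ : Fin 1 => bTilde 𝒱 lam b R) (fun _ => -1) n = 0 := by
    intro n _
    rw [brace_one_eq_tri, tri_twist_self (reduce_zero R) hRS hb hbt h.comp_eq_tri]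
    rfl
  have hsource := isAInfinityAlgebra_desuspend 𝒱 hbtdeg hsq
  refine ⟨hsource, ⟨hsource, isAInfinityAlgebra_desuspend 𝒱 h.degree_b h.ainfinity, ?_, ?_⟩,
    ⟨hbtdeg, ?_, hsq, ?_⟩⟩
  · intro n hn
    exact IsHomogeneous.desuspend 𝒱 (h.degree_R n hn)
  · intro n hn
    -- Since the sign operator of (de)suspension is an involution, the morphism equation is the
    -- Rota–Baxter equation with its right side collected into b̃.
    rw [suspend_desuspend, suspend_desuspend, suspend_desuspend, h.rotaBaxter n hn,
      sum_brace_brace, brace_one_eq_tri]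
  · exact fun n hn => isHomogeneous_suspGrading_iff.1 (hRtdeg n hn)
  · intro n hn
    rw [sum_brace_brace, compAll_eq_comp]
    exact congrFun (comp_twist hRtS hbt (RTilde_eq_tri_reduce 𝒱 R lam)
      (funext fun n => bTilde_eq_tri 𝒱 _ _ lam n) h.comp_eq_tri) n
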